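/- Let $\mathbb H(\mathbb C)$ be the algebra of quaternions over $\mathbb C$, with basis $1,I,J,K$ ($I^2=J^2=K^2=-1$, $IJ=-JI=K$, $JK=-KJ=I$, $KI=-IK=J$), and put $$e_1=\tfrac12(1+iI),\quad e_2=\tfrac12(1-iI),\quad e_3=\tfrac12(iJ-K),\quad e_4=\tfrac12(iJ+K).$$ Let $f_1,f_2:\mathbb H(\mathbb C)\to\mathbb C$ be the $\mathbb C$-linear functionals with $f_1(e_1)=f_1(e_3)=1$, $f_1(e_2)=f_1(e_4)=0$ and $f_2(e_2)=f_2(e_4)=1$, $f_2(e_1)=f_2(e_3)=0$. Let $a_1,a_2,b_1,b_2\in\mathbb C$ be such that $1$, $i_2=a_1e_1+a_2e_2$, $i_3=b_1e_1+b_2e_2$ are linearly independent over $\mathbb R$; let $E_3=\{x+yi_2+zi_3:x,y,z\in\mathbb R\}$, and for $S\subset\mathbb R^3$ let $S_\zeta=\{x+yi_2+zi_3:(x,y,z)\in S\}$. Suppose that $f_1(E_3)=f_2(E_3)=\mathbb C$. For $k=1,2$ let $L^k\subset\mathbb R^3$ be the straight line $\{(x,y,z): x+ya_k+zb_k=0\}$.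 Let $\Omega\subset\mathbb R^3$ be a domain that is convex in the direction of $L^1$ and of $L^2$, i.e. it contains every segment parallel to $L^1$ or $L^2$ whose endpoints lie in $\Omega$. Let $\Phi,\widehat\Phi:\Omega_\zeta\to\mathbb H(\mathbb C)$ be continuous, $\Phi$ right-$G$-monogenic and $\widehat\Phi$ left-$G$-monogenic, i.e. for every $\zeta\in\Omega_\zeta$ there are $\Phi'(\zeta),\widehat\Phi'(\zeta)\in\mathbb H(\mathbb C)$ such that for all $h\in E_3$ $$\lim_{\varepsilon\to0+}\frac{\Phi(\zeta+\varepsilon h)-\Phi(\zeta)}{\varepsilon}=h\,\Phi'(\zeta),\qquad \lim_{\varepsilon\to0+}\frac{\widehat\Phi(\zeta+\varepsilon h)-\widehat\Phi(\zeta)}{\varepsilon}=\widehat\Phi'(\zeta)\,h .$$ Let $\zeta_0\in\Omega_\zeta$, let $p_0\in\Omega$ be the corresponding point, and let $M=(p_0+L^1)\cup(p_0+L^2)$. Let $\gamma$ be a closed rectifiable Jordan curve in $\Omega$ that embraces $M$ once in the positive direction, i.e. $\gamma$ is (freely) homotopic in $\Omega\setminus M$ to a circle $C$ with centre $p_0$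 that lies in a ball around $p_0$ contained in $\Omega$, such that for $k=1,2$ the image $C_k$ of $C_\zeta$ under $f_k$ bounds a domain of $\mathbb C$ that contains $f_k(\zeta_0)$ and is run through once counterclockwise. Then the following integrals exist and $$\Phi(\zeta_0)=\frac1{2\pi i}\int_{\gamma_\zeta}(\zeta-\zeta_0)^{-1}\,d\zeta\,\Phi(\zeta),\qquad \widehat\Phi(\zeta_0)=\frac1{2\pi i}\int_{\gamma_\zeta}\widehat\Phi(\zeta)(\zeta-\zeta_0)^{-1}\,d\zeta .$$ Here $d\zeta=dx+i_2\,dy+i_3\,dz$, and the integrals are Riemann–Stieltjes integrals along $\gamma$, taken componentwise with respect to the basis $e_1,\dots,e_4$. -/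

import Mathlib

open scoped Quaternion Topology

namespace GMonogenic

noncomputable section

/-! ### The algebra of complex quaternions

`ℍ[ℂ]` is Mathlib's quaternion algebra over `ℂ`, with basis `1, I, J, K`, `I² = J² = K² = -1`,
`IJ = K = -JI`. It is a four-dimensional complex vector space with the usual topology. -/

instance : TopologicalSpace ℍ[ℂ] :=
  TopologicalSpace.induced (QuaternionAlgebra.equivTuple (-1 : ℂ) 0 (-1)) inferInstance

/-- The quaternionic unit `I`. -/
def qI : ℍ[ℂ] := ⟨0, 1, 0, 0⟩
/-- The quaternionic unit `J`. -/
def qJ : ℍ[ℂ] := ⟨0, 0, 1, 0⟩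
/-- The quaternionic unit `K`. -/
def qK : ℍ[ℂ] := ⟨0, 0, 0, 1⟩

/-- The basis `e₁, e₂, e₃, e₄` of `ℍ[ℂ]` (indexed by `0, 1, 2, 3`). -/
def e : Fin 4 → ℍ[ℂ] :=
  ![(1 / 2 : ℂ) • (1 + Complex.I • qI), (1 / 2 : ℂ) • (1 - Complex.I • qI),
    (1 / 2 : ℂ) • (Complex.I • qJ - qK), (1 / 2 : ℂ) • (Complex.I • qJ + qK)]

/-- The complex coordinates of an element of `ℍ[ℂ]` with respect to `e₁, e₂, e₃, e₄`. -/
def coord : Fin 4 → ℍ[ℂ] → ℂ :=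
  ![fun w => w.re - Complex.I * w.imI, fun w => w.re + Complex.I * w.imI,
    fun w => -Complex.I * w.imJ - w.imK, fun w => -Complex.I * w.imJ + w.imK]

theorem qI_parts : qI.re = 0 ∧ qI.imI = 1 ∧ qI.imJ = 0 ∧ qI.imK = 0 := ⟨rfl, rfl, rfl, rfl⟩
theorem qJ_parts : qJ.re = 0 ∧ qJ.imI = 0 ∧ qJ.imJ = 1 ∧ qJ.imK = 0 := ⟨rfl, rfl, rfl, rfl⟩
theorem qK_parts : qK.re = 0 ∧ qK.imI = 0 ∧ qK.imJ = 0 ∧ qK.imK = 1 := ⟨rfl, rfl, rfl, rfl⟩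

theorem sum_coord_smul_e (w : ℍ[ℂ]) : ∑ k, coord k w • e k = w := by
  simp only [Fin.sum_univ_four, coord, e]
  ext <;> simp [qI_parts, qJ_parts, qK_parts] <;> ring_nf <;> simp

theorem coord_e (j k : Fin 4) : coord j (e k) = if j = k then 1 else 0 := by
  fin_cases j <;> fin_cases k <;>
    simp [coord, e, qI_parts, qJ_parts, qK_parts] <;> ring_nf <;> simp <;> ring

/-- The linear functional with `f₁(e₁) = f₁(e₃) = 1`, `f₁(e₂) = f₁(e₄) = 0`. -/
def f₁ : ℍ[ℂ] →ₗ[ℂ] ℂ where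
  toFun w := coord 0 w + coord 2 w
  map_add' v w := by simp [coord]; ring
  map_smul' c w := by simp [coord]; ring

/-- The linear functional with `f₂(e₂) = f₂(e₄) = 1`, `f₂(e₁) = f₂(e₃) = 0`. -/
def f₂ : ℍ[ℂ] →ₗ[ℂ] ℂ where
  toFun w := coord 1 w + coord 3 w
  map_add' v w := by simp [coord]; ring
  map_smul' c w := by simp [coord]; ring

/-! ### The subspace `E₃` -/

/-- Three-dimensional Euclidean space. -/
abbrev R3 := EuclideanSpace ℝ (Fin 3)

/-- The vector `c₁ e₁ + c₂ e₂`. Then `i₂ = vec a₁ a₂` and `i₃ = vec b₁ b₂`. -/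
def vec (c₁ c₂ : ℂ) : ℍ[ℂ] := c₁ • e 0 + c₂ • e 1

/-- The point `ζ = x + y i₂ + z i₃` that corresponds to `(x, y, z)`, where `i₂ = a₁ e₁ + a₂ e₂` and
`i₃ = b₁ e₁ + b₂ e₂`. For `S ⊆ ℝ³` the set `S_ζ` is the image `zeta a₁ a₂ b₁ b₂ '' S`. -/
def zeta (a₁ a₂ b₁ b₂ : ℂ) (p : R3) : ℍ[ℂ] :=
  p 0 • (1 : ℍ[ℂ]) + p 1 • vec a₁ a₂ + p 2 • vec b₁ b₂

/-- `E₃`, the real linear span of `1, i₂, i₃`. -/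
def E₃ (a₁ a₂ b₁ b₂ : ℂ) : Set ℍ[ℂ] := Set.range (zeta a₁ a₂ b₁ b₂)

/-- The set of the points of `ℝ³` with `x + y a + z b = 0`, written in real coordinates. The line
`L¹` is `line a₁ b₁` and the line `L²` is `line a₂ b₂`. -/
def line (a b : ℂ) : Set R3 :=
  {p | p 0 + p 1 * a.re + p 2 * b.re = 0 ∧ p 1 * a.im + p 2 * b.im = 0}

/-- `Ω` is convex in the direction of the line `L` through the origin: it contains every segment
that is parallel to `L` and has its endpoints in `Ω`. -/
def ConvexInDirection (Ω L : Set R3) : Prop :=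
  ∀ p ∈ Ω, ∀ q ∈ Ω, q - p ∈ L → segment ℝ p q ⊆ Ω

/-- A domain: a nonempty connected open set. -/
def IsDomain3 (Ω : Set R3) : Prop := IsOpen Ω ∧ IsConnected Ω

/-! ### `G`-monogenic mappings -/

/-- `Φ` is right-`G`-monogenic in `Ω_ζ`. -/
def RightGMonogenic (a₁ a₂ b₁ b₂ : ℂ) (Ω : Set R3) (Φ : ℍ[ℂ] → ℍ[ℂ]) : Prop :=
  ContinuousOn (fun p => Φ (zeta a₁ a₂ b₁ b₂ p)) Ω ∧
  ∀ ζ ∈ zeta a₁ a₂ b₁ b₂ '' Ω, ∃ Φ' : ℍ[ℂ], ∀ h ∈ E₃ a₁ a₂ b₁ b₂,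
    Filter.Tendsto (fun ε : ℝ => ε⁻¹ • (Φ (ζ + ε • h) - Φ ζ)) (𝓝[>] 0) (𝓝 (h * Φ'))

/-- `Φ` is left-`G`-monogenic in `Ω_ζ`. -/
def LeftGMonogenic (a₁ a₂ b₁ b₂ : ℂ) (Ω : Set R3) (Φ : ℍ[ℂ] → ℍ[ℂ]) : Prop :=
  ContinuousOn (fun p => Φ (zeta a₁ a₂ b₁ b₂ p)) Ω ∧
  ∀ ζ ∈ zeta a₁ a₂ b₁ b₂ '' Ω, ∃ Φ' : ℍ[ℂ], ∀ h ∈ E₃ a₁ a₂ b₁ b₂,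
    Filter.Tendsto (fun ε : ℝ => ε⁻¹ • (Φ (ζ + ε • h) - Φ ζ)) (𝓝[>] 0) (𝓝 (Φ' * h))

/-! ### Curves and curvilinear integrals

A curve is given by a parametrization on `[0, 1]`. -/

/-- `γ` is a closed Jordan rectifiable curve. -/
structure IsClosedJordanRectifiable (γ : ℝ → R3) : Prop where
  continuousOn : ContinuousOn γ (Set.Icc 0 1)
  closed : γ 0 = γ 1
  injOn : Set.InjOn γ (Set.Ico 0 1)
  rectifiable : BoundedVariationOn γ (Set.Icc 0 1)

/-- The Riemann-Stieltjes integral `∫₀¹ u(t) dg(t)` exists and equals `S`: the tagged sums converge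
to `S` as the mesh of the partition `0 = t₀ ≤ t₁ ≤ ⋯ ≤ tₙ = 1` tends to `0`. -/
def HasStieltjesIntegral (u g : ℝ → ℝ) (S : ℝ) : Prop :=
  ∀ ε > 0, ∃ δ > 0, ∀ (n : ℕ) (t s : ℕ → ℝ), Monotone t → t 0 = 0 → t n = 1 →
    (∀ i < n, t (i + 1) - t i < δ) → (∀ i < n, s i ∈ Set.Icc (t i) (t (i + 1))) →
    |∑ i ∈ Finset.range n, u (s i) * (g (t (i + 1)) - g (t i)) - S| < ε

/-- The value of the integral is unique. -/
theorem HasStieltjesIntegral.unique {u g : ℝ → ℝ} {S T : ℝ} (hS : HasStieltjesIntegral u g S)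
    (hT : HasStieltjesIntegral u g T) : S = T := by
  by_contra hne
  have hp : 0 < |S - T| / 2 := by
    have := abs_pos.2 (sub_ne_zero.2 hne)
    linarith
  obtain ⟨d, hd, H⟩ := hS _ hp
  obtain ⟨d', hd', H'⟩ := hT _ hp
  obtain ⟨n, hn⟩ := exists_nat_one_div_lt (lt_min hd hd')
  have hn1 : (0 : ℝ) < n + 1 := by positivity
  let t : ℕ → ℝ := fun i => i / (n + 1)
  have A : ∀ i, t (i + 1) - t i = 1 / (n + 1) := fun i => by simp [t]; ring
  have mono : Monotone t := fun i j hij => by simp only [t]; gcongr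
  have ht1 : t (n + 1) = 1 := by simp [t, hn1.ne']
  have B1 := H (n + 1) t t mono (by simp [t]) ht1
    (fun i _ => by rw [A]; exact hn.trans_le (min_le_left _ _))
    (fun i _ => ⟨le_rfl, mono (Nat.le_succ i)⟩)
  have B2 := H' (n + 1) t t mono (by simp [t]) ht1
    (fun i _ => by rw [A]; exact hn.trans_le (min_le_right _ _))
    (fun i _ => ⟨le_rfl, mono (Nat.le_succ i)⟩)
  rw [abs_lt] at B1 B2
  rcases abs_cases (S - T) with h | h <;> linarith [h.1]

/-- Along the curve `γ`, for `Ψ = ∑ₖ Uₖ eₖ + i ∑ₖ Vₖ eₖ` (a function of the parameter) with real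
`Uₖ`, `Vₖ`, and for the coordinate `xⱼ` of `ℝ³`, the integral
`∑ₖ eₖ ∫ Uₖ dxⱼ + i ∑ₖ eₖ ∫ Vₖ dxⱼ` exists and equals `W`. -/
def HasCoordIntegral (γ : ℝ → R3) (j : Fin 3) (Ψ : ℝ → ℍ[ℂ]) (W : ℍ[ℂ]) : Prop :=
  ∀ k : Fin 4,
    HasStieltjesIntegral (fun t => (coord k (Ψ t)).re) (fun t => γ t j) (coord k W).re ∧
    HasStieltjesIntegral (fun t => (coord k (Ψ t)).im) (fun t => γ t j) (coord k W).im

/-- The integral `∫ A(ζ) dζ B(ζ)` along `γ_ζ`, where `dζ = dx + i₂ dy + i₃ dz`, exists and equals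
`W`. The factors stand in this order, so that `A = 1` gives `∫ dζ B(ζ)` and `B = 1` gives
`∫ A(ζ) dζ`. -/
def HasCurveIntegral (a₁ a₂ b₁ b₂ : ℂ) (γ : ℝ → R3) (A B : ℍ[ℂ] → ℍ[ℂ]) (W : ℍ[ℂ]) : Prop :=
  ∃ X Y Z : ℍ[ℂ],
    HasCoordIntegral γ 0
      (fun t => A (zeta a₁ a₂ b₁ b₂ (γ t)) * B (zeta a₁ a₂ b₁ b₂ (γ t))) X ∧
    HasCoordIntegral γ 1
      (fun t => A (zeta a₁ a₂ b₁ b₂ (γ t)) * vec a₁ a₂ * B (zeta a₁ a₂ b₁ b₂ (γ t))) Y ∧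
    HasCoordIntegral γ 2
      (fun t => A (zeta a₁ a₂ b₁ b₂ (γ t)) * vec b₁ b₂ * B (zeta a₁ a₂ b₁ b₂ (γ t))) Z ∧
    W = X + Y + Z

/-! ### Curves that embrace the singular lines through a point -/

/-- The points `p` for which `p - p₀` lies on one of the lines `L¹`, `L²`. -/
def singularSet (a₁ a₂ b₁ b₂ : ℂ) (p₀ : R3) : Set R3 :=
  {p | p - p₀ ∈ line a₁ b₁ ∪ line a₂ b₂}

/-- The circle with centre `p₀` and radius `r` in the plane through `p₀` that is spanned by the
orthonormal vectors `u`, `v`, run through once, from `u` to `v`, as `t` goes from `0` to `1`. -/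
def circle (p₀ u v : R3) (r t : ℝ) : R3 :=
  p₀ + r • (Real.cos (2 * Real.pi * t) • u + Real.sin (2 * Real.pi * t) • v)

/-- The set `C ⊆ ℂ` bounds a domain that contains `ξ`. -/
def BoundsDomainAround (C : Set ℂ) (ξ : ℂ) : Prop :=
  ∃ D : Set ℂ, IsOpen D ∧ IsConnected D ∧ Bornology.IsBounded D ∧ frontier D = C ∧ ξ ∈ D

/-- The circle `circle p₀ u v r` embraces the lines through `p₀` that are parallel to `L¹`, `L²`:
each of its images `C₁`, `C₂` under `f₁`, `f₂` bounds a domain that contains the image of its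
centre. -/
def CircleEmbraces (a₁ a₂ b₁ b₂ : ℂ) (p₀ u v : R3) (r : ℝ) : Prop :=
  BoundsDomainAround
    ((fun t => f₁ (zeta a₁ a₂ b₁ b₂ (circle p₀ u v r t))) '' Set.Icc 0 1)
    (f₁ (zeta a₁ a₂ b₁ b₂ p₀)) ∧
  BoundsDomainAround
    ((fun t => f₂ (zeta a₁ a₂ b₁ b₂ (circle p₀ u v r t))) '' Set.Icc 0 1)
    (f₂ (zeta a₁ a₂ b₁ b₂ p₀))

/-- The pair `(w, w')` is a positively oriented real basis of `ℂ`. -/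
def PositivelyOriented (w w' : ℂ) : Prop := 0 < (starRingEnd ℂ w * w').im

/-- Both images `C₁`, `C₂` of `circle p₀ u v r` are run through counterclockwise: `Cₖ` is the
ellipse `ξₖ⁽⁰⁾ + r (cos(2πt) fₖ(u) + sin(2πt) fₖ(v))`. -/
def CirclePositive (a₁ a₂ b₁ b₂ : ℂ) (u v : R3) : Prop :=
  PositivelyOriented (f₁ (zeta a₁ a₂ b₁ b₂ u)) (f₁ (zeta a₁ a₂ b₁ b₂ v)) ∧
  PositivelyOriented (f₂ (zeta a₁ a₂ b₁ b₂ u)) (f₂ (zeta a₁ a₂ b₁ b₂ v))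

/-- The closed curves `γ` and `η` are (freely) homotopic, through closed curves, in the set `X`. -/
def ClosedHomotopicIn (X : Set R3) (γ η : ℝ → R3) : Prop :=
  ∃ H : ℝ × ℝ → R3, ContinuousOn H (Set.Icc 0 1 ×ˢ Set.Icc 0 1) ∧
    (∀ t ∈ Set.Icc (0 : ℝ) 1, H (0, t) = γ t) ∧
    (∀ t ∈ Set.Icc (0 : ℝ) 1, H (1, t) = η t) ∧
    (∀ s ∈ Set.Icc (0 : ℝ) 1, H (s, 0) = H (s, 1)) ∧
    (∀ s ∈ Set.Icc (0 : ℝ) 1, ∀ t ∈ Set.Icc (0 : ℝ) 1, H (s, t) ∈ X)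

/-- The closed curve `γ` in `Ω` embraces once (in the positive direction) the lines through `p₀`
that are parallel to `L¹`, `L²`: it is homotopic, in `Ω` without these lines, to a positively
oriented circle with centre `p₀` that embraces them and lies in a ball around `p₀` contained
in `Ω`. -/
def EmbracesOnce (a₁ a₂ b₁ b₂ : ℂ) (Ω : Set R3) (p₀ : R3) (γ : ℝ → R3) : Prop :=
  ∃ (u v : R3) (r ρ : ℝ), Orthonormal ℝ ![u, v] ∧ 0 < r ∧ r < ρ ∧ Metric.ball p₀ ρ ⊆ Ω ∧
    CircleEmbraces a₁ a₂ b₁ b₂ p₀ u v r ∧ CirclePositive a₁ a₂ b₁ b₂ u v ∧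
    ClosedHomotopicIn (Ω \ singularSet a₁ a₂ b₁ b₂ p₀) γ (circle p₀ u v r)

end

end GMonogenic

/-! ### Looman–Menchoff theorem: growth estimates near the set of non-analytic points -/

namespace GMonogenic

open MeasureTheory Complex Metric

/-! The four-dimensional formula splits into four scalar Cauchy formulas in the plane. Every point
of `E₃` is `ξ₁ e₁ + ξ₂ e₂` with `ξₖ = x + y aₖ + z bₖ`, and multiplication by such an element, from
either side, is diagonal in `e₁, …, e₄` with eigenvalues `ξ₁, ξ₂` (`coord_vec_mul`,
`coord_mul_vec`). So each coordinate `U` of a monogenic mapping has one-sided directional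
derivatives `ξ(h) d`, with `ξ` one of the two functionals. They vanish along the kernel of `ξ`, the
line `Lᵏ`; convexity in that direction makes `U` constant on the fibres of `ξ` in `Ω`, and hence `U
= F ∘ ξ` with `F` continuous on the open set `ξ(Ω)` (`exists_differentiableOn_comp_eq`).

Only the existence of directional derivatives of `F` is known, with the Cauchy–Riemann relation but
no continuity or local bound. Holomorphy is therefore the Looman–Menchoff theorem
(`differentiableOn_of_partial`). Its proof uses Baire category to make the growth of `F` along the
axes uniform on a portion of the non-analytic set, the maximum principle in quadrants to extend it
to all directions, Cauchy's estimate to bound the derivative, and finally Fubini and Morera.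

In the plane, `ξ ∘ γ` is homotopic in `ξ(Ω)` without `ξ(p₀)` to a positively oriented ellipse around
`ξ(p₀)`, which shrinks and then deforms to a small circle. Since `γ` is only rectifiable, the
homotopies are applied to integrals over inscribed polygons. These are eventually equal to the
circle integral and have the same limit as the Stieltjes sums (`tendsto_sum_cauchy_kernel`). The
Stieltjes integrals exist because integrands and integrators are continuous and the latter have
bounded variation; comparing limits over uniform partitions identifies their values. -/

theorem norm_le_norm_add_of_re_im_nonneg {a b : ℂ} (ha : 0 ≤ a.re) (ha' : 0 ≤ a.im)
    (hb : 0 ≤ b.re) (hb' : 0 ≤ b.im) : ‖a‖ ≤ ‖a + b‖ := by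
  rw [Complex.norm_def, Complex.norm_def]
  apply Real.sqrt_le_sqrt
  simp only [normSq_apply, add_re, add_im]
  nlinarith [mul_nonneg ha hb, mul_nonneg ha' hb', mul_nonneg hb hb, mul_nonneg hb' hb']

/-- A Phragmén–Lindelöf argument in a quadrant with vertex `w`: linear growth from `w` on the
boundary propagates to the interior. -/
theorem norm_sub_le_of_quadrant {V : Set ℂ} (hVb : Bornology.IsBounded V)
    {F : ℂ → ℂ} (hd : DifferentiableOn ℂ F V) (hc : ContinuousOn F (closure V)) {w c : ℂ}
    (hcn : ‖c‖ = 1) (hV : ∀ z ∈ closure V, 0 ≤ ((z - w) / c).re ∧ 0 ≤ ((z - w) / c).im) {C : ℝ}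
    (hC : 0 ≤ C) (hfr : ∀ z ∈ frontier V, ‖F z - F w‖ ≤ C * ‖z - w‖) {z : ℂ} (hz : z ∈ V) :
    ‖F z - F w‖ ≤ C * ‖z - w‖ := by
  have hc0 : c ≠ 0 := by rintro rfl; simp at hcn
  -- Dividing by `z - w` would be singular at the vertex, so the pole is moved to `w - c * b`,
  -- outside the closed quadrant. Since `(z - w) / c` and `b` both lie in the closed first quadrant,
  -- the shift only increases the modulus of the denominator; letting `ε → 0` removes it.
  have key : ∀ ε : ℝ, 0 < ε → ‖F z - F w‖ ≤ C * (‖z - w‖ + ε * 2) := by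
    intro ε hε
    set b : ℂ := ε * (1 + I) with hb
    have hbre : b.re = ε := by simp [hb]
    have hbim : b.im = ε := by simp [hb]
    have heq : ∀ z : ℂ, z - w + c * b = c * ((z - w) / c + b) := fun z => by field_simp
    have hle : ∀ z ∈ closure V, ‖z - w‖ ≤ ‖z - w + c * b‖ := by
      intro z hz
      have := norm_le_norm_add_of_re_im_nonneg (b := b) (hV z hz).1 (hV z hz).2
        (by rw [hbre]; exact hε.le) (by rw [hbim]; exact hε.le)
      rw [heq, norm_mul, hcn, one_mul]
      rwa [norm_div, hcn, div_one] at this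
    have hne : ∀ z ∈ closure V, z - w + c * b ≠ 0 := by
      intro z hz h0
      rw [heq] at h0
      have h1 := (mul_eq_zero.1 h0).resolve_left hc0
      have h2 := congrArg Complex.re h1
      rw [add_re, hbre, zero_re] at h2
      linarith [(hV z hz).1]
    have hH : DiffContOnCl ℂ (fun z => (F z - F w) / (z - w + c * b)) V :=
      ⟨(hd.sub_const _).div (by fun_prop) fun z hz => hne z (subset_closure hz),
        (hc.sub continuousOn_const).div (by fun_prop) hne⟩
    have h1 : ‖(F z - F w) / (z - w + c * b)‖ ≤ C := by
      refine Complex.norm_le_of_forall_mem_frontier_norm_le hVb hH (fun z hz => ?_)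
        (subset_closure hz)
      have hzc := frontier_subset_closure hz
      rw [norm_div, div_le_iff₀ (norm_pos_iff.2 (hne z hzc))]
      exact (hfr z hz).trans (mul_le_mul_of_nonneg_left (hle z hzc) hC)
    rw [norm_div, div_le_iff₀ (norm_pos_iff.2 (hne z (subset_closure hz)))] at h1
    refine h1.trans (mul_le_mul_of_nonneg_left ((norm_add_le _ _).trans ?_) hC)
    gcongr
    rw [norm_mul, hcn, one_mul, hb, norm_mul, norm_real, Real.norm_of_nonneg hε.le]
    gcongr
    exact (norm_add_le _ _).trans (by norm_num)
  refine ge_of_tendsto (f := fun ε : ℝ => C * (‖z - w‖ + ε * 2)) (x := 𝓝[>] 0) ?_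
    (Filter.eventually_of_mem self_mem_nhdsWithin key)
  have : Filter.Tendsto (fun ε : ℝ => C * (‖z - w‖ + ε * 2)) (𝓝 0)
      (𝓝 (C * (‖z - w‖ + 0 * 2))) := Continuous.tendsto (by fun_prop) 0
  simpa using this.mono_left nhdsWithin_le_nhds

/-- If `F` is holomorphic off the closed set `S`, and grows linearly from the points of `S` on the
axis-parallel lines and on `S`, then it grows linearly from the points of `S`. -/
theorem exists_norm_sub_le_of_axes {w₀ : ℂ} {r n M : ℝ} (hr : 0 < r) (hn : 0 ≤ n) {S : Set ℂ}
    (hS : IsClosed S) {F : ℂ → ℂ} (hc : ContinuousOn F (closedBall w₀ r))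
    (hd : DifferentiableOn ℂ F (ball w₀ r \ S)) (hM : ∀ z ∈ closedBall w₀ r, ‖F z‖ ≤ M)
    (hax : ∀ w ∈ S ∩ ball w₀ r, ∀ z ∈ ball w₀ r, (z.re = w.re ∨ z.im = w.im) →
      ‖F z - F w‖ ≤ n * ‖z - w‖)
    (hSS : ∀ w ∈ S ∩ ball w₀ r, ∀ z ∈ S ∩ ball w₀ r, ‖F z - F w‖ ≤ n * ‖z - w‖) :
    ∃ C, 0 ≤ C ∧ ∀ w ∈ S ∩ ball w₀ (r / 2), ∀ z ∈ ball w₀ r, ‖F z - F w‖ ≤ C * ‖z - w‖ := by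
  have hM0 : 0 ≤ M := (norm_nonneg _).trans (hM w₀ (mem_closedBall_self hr.le))
  -- The summand `n` serves the axes and `S`. The other serves the boundary circle, where the
  -- increment of `F` is at most `2 * M` and the distance to `w` is at least `r / 2`.
  refine ⟨n + 4 * M / r, by positivity, fun w hw z hz => ?_⟩
  have hwr : w ∈ S ∩ ball w₀ r := ⟨hw.1, ball_subset_ball (by linarith) hw.2⟩
  have hnC : ∀ x : ℂ, n * ‖x‖ ≤ (n + 4 * M / r) * ‖x‖ := fun x => by
    gcongr
    have : 0 ≤ 4 * M / r := by positivity
    linarith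
  -- The unit `c` rotates the first quadrant to the one at `w` that contains `z`; it will be `1`,
  -- `I`, `-1` or `-I`.
  have main : ∀ c : ℂ, ‖c‖ = 1 →
      (∀ z, (((z - w) / c).re = 0 ∨ ((z - w) / c).im = 0) → (z.re = w.re ∨ z.im = w.im)) →
      z ∉ S → 0 < ((z - w) / c).re → 0 < ((z - w) / c).im →
      ‖F z - F w‖ ≤ (n + 4 * M / r) * ‖z - w‖ := by
    intro c hcn hcax hzS h1 h2
    have hcr : Continuous fun z : ℂ => ((z - w) / c).re := by fun_prop
    have hci : Continuous fun z : ℂ => ((z - w) / c).im := by fun_prop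
    set V : Set ℂ := (ball w₀ r \ S) ∩ ({z | 0 < ((z - w) / c).re} ∩ {z | 0 < ((z - w) / c).im})
      with hVdef
    have hVo : IsOpen V := (isOpen_ball.sdiff hS).inter
      ((isOpen_lt continuous_const hcr).inter (isOpen_lt continuous_const hci))
    have hVcl : closure V ⊆ closedBall w₀ r :=
      (closure_mono fun z hz => hz.1.1).trans closure_ball_subset_closedBall
    have hVq : ∀ z ∈ closure V, 0 ≤ ((z - w) / c).re ∧ 0 ≤ ((z - w) / c).im := by
      intro z hz
      refine closure_minimal (t := {z | 0 ≤ ((z - w) / c).re} ∩ {z | 0 ≤ ((z - w) / c).im})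
        (fun z hz => by
          simp only [hVdef, Set.mem_inter_iff, Set.mem_ofPred_eq] at hz ⊢
          exact ⟨hz.2.1.le, hz.2.2.le⟩)
        ((isClosed_le continuous_const hcr).inter (isClosed_le continuous_const hci)) hz
    refine norm_sub_le_of_quadrant (isBounded_ball.subset fun z hz => hz.1.1)
      (hd.mono fun z hz => hz.1) (hc.mono hVcl) hcn hVq (by positivity) ?_ ⟨⟨hz, hzS⟩, h1, h2⟩
    intro y hy
    rw [hVo.frontier_eq] at hy
    have hyq := hVq y hy.1
    by_cases hyb : y ∈ ball w₀ r
    · by_cases hyS : y ∈ S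
      · exact (hSS w hwr y ⟨hyS, hyb⟩).trans (hnC _)
      · refine (hax w hwr y hyb (hcax y ?_)).trans (hnC _)
        by_contra hcon
        push Not at hcon
        exact hy.2 ⟨⟨hyb, hyS⟩, lt_of_le_of_ne hyq.1 hcon.1.symm, lt_of_le_of_ne hyq.2 hcon.2.symm⟩
    · have hdist : r / 2 ≤ ‖y - w‖ := by
        have h3 : r ≤ dist y w₀ := not_lt.1 hyb
        have h4 : dist w w₀ < r / 2 := hw.2
        have := dist_triangle y w w₀
        rw [← dist_eq_norm]
        linarith
      calc ‖F y - F w‖ ≤ ‖F y‖ + ‖F w‖ := norm_sub_le _ _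
        _ ≤ M + M := add_le_add (hM y (hVcl hy.1)) (hM w (ball_subset_closedBall hwr.2))
        _ = 4 * M / r * (r / 2) := by field_simp; ring
        _ ≤ 4 * M / r * ‖y - w‖ := by gcongr
        _ ≤ (n + 4 * M / r) * ‖y - w‖ := by gcongr; linarith
  by_cases hzS : z ∈ S
  · exact (hSS w hwr z ⟨hzS, hz⟩).trans (hnC _)
  rcases lt_trichotomy z.re w.re with hre | hre | hre
  · rcases lt_trichotomy z.im w.im with him | him | him
    · exact main (-1) (by simp) (fun z => by simp [div_neg, sub_eq_zero, eq_comm]) hzS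
        (by simpa [div_neg] using hre) (by simpa [div_neg] using him)
    · exact (hax w hwr z hz (Or.inr him)).trans (hnC _)
    · exact main I (by simp) (fun z => by simp [sub_eq_zero, or_comm, eq_comm]) hzS
        (by simpa using him) (by simpa using hre)
  · exact (hax w hwr z hz (Or.inl hre)).trans (hnC _)
  · rcases lt_trichotomy z.im w.im with him | him | him
    · exact main (-I) (by simp) (fun z => by simp [sub_eq_zero, or_comm, eq_comm, div_neg]) hzS
        (by simpa [div_neg] using him) (by simpa [div_neg] using hre)
    · exact (hax w hwr z hz (Or.inr him)).trans (hnC _)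
    · exact main 1 (by simp) (fun z => by simp [sub_eq_zero]) hzS (by simpa using hre)
        (by simpa using him)

/-- Linear growth from the points of `S` bounds the derivative near a point of `S`. -/
theorem norm_deriv_le_of_linear_growth {w₀ : ℂ} {r C : ℝ} {S : Set ℂ} (hS : IsClosed S)
    (hw₀ : w₀ ∈ S) {F : ℂ → ℂ} (hc : ContinuousOn F (ball w₀ r))
    (hd : DifferentiableOn ℂ F (ball w₀ r \ S))
    (hC : ∀ w ∈ S ∩ ball w₀ (r / 2), ∀ z ∈ ball w₀ r, ‖F z - F w‖ ≤ C * ‖z - w‖) (hC0 : 0 ≤ C)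
    {z : ℂ} (hz : z ∈ ball w₀ (r / 4)) {d : ℂ} (hzd : HasDerivAt (fun t : ℝ => F (z + t)) d 0) :
    ‖d‖ ≤ 2 * C := by
  have hr : 0 < r := by linarith [pos_of_mem_ball hz]
  have hzr : z ∈ ball w₀ r := ball_subset_ball (by linarith) hz
  by_cases hzS : z ∈ S
  · have hcont : Continuous fun t : ℝ => z + t := by fun_prop
    have : ∀ᶠ t : ℝ in 𝓝 0, ‖F (z + t) - F (z + (0 : ℝ))‖ ≤ C * ‖t - 0‖ := by
      have : ∀ᶠ t : ℝ in 𝓝 0, z + t ∈ ball w₀ r :=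
        hcont.continuousAt.eventually_mem (isOpen_ball.mem_nhds (by simpa using hzr))
      filter_upwards [this] with t ht
      simpa using hC z ⟨hzS, ball_subset_ball (by linarith) hz⟩ _ ht
    linarith [hzd.le_of_lip' hC0 this]
  -- The open disc about `z` reaching to the nearest point `w` of `S` misses `S`. On its rim `‖F - F
  -- w‖` is at most `C` times the diameter, so Cauchy's estimate gives `2 * C` whatever the radius.
  -- The radius `r / 4` keeps `w` in `ball w₀ (r / 2)` and the closed disc in `ball w₀ r`.
  · obtain ⟨w, hwS, hwd⟩ := hS.exists_infDist_eq_dist ⟨w₀, hw₀⟩ z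
    have hdle : dist z w ≤ dist z w₀ := hwd ▸ infDist_le_dist_of_mem hw₀
    have hzr4 : dist z w₀ < r / 4 := hz
    have hdpos : 0 < dist z w := dist_pos.2 fun h => hzS (h ▸ hwS)
    have hw2 : w ∈ ball w₀ (r / 2) := by
      have := dist_triangle_left w w₀ z
      rw [mem_ball]
      linarith
    have hsub : closedBall z (dist z w) ⊆ ball w₀ r := by
      intro y hy
      have := dist_triangle y z w₀
      rw [mem_closedBall] at hy
      rw [mem_ball]
      linarith
    have hdisj : ball z (dist z w) ⊆ ball w₀ r \ S := fun y hy =>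
      ⟨hsub (ball_subset_closedBall hy), fun hyS => by
        have := infDist_le_dist_of_mem (x := z) hyS
        rw [hwd, dist_comm z y] at this
        exact absurd hy (not_lt.2 this)⟩
    have hdc : DiffContOnCl ℂ (fun y => F y - F w) (ball z (dist z w)) :=
      ⟨(hd.mono hdisj).sub_const _,
        (hc.mono (closure_ball_subset_closedBall.trans hsub)).sub continuousOn_const⟩
    have hbound := Complex.norm_deriv_le_of_forall_mem_sphere_norm_le (C := C * (2 * dist z w))
      hdpos hdc fun y hy => by
        refine (hC w ⟨hwS, hw2⟩ y (hsub (sphere_subset_closedBall hy))).trans ?_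
        gcongr
        rw [← dist_eq_norm]
        have := dist_triangle y z w
        rw [mem_sphere] at hy
        linarith
    have hF : HasDerivAt F (deriv F z) z :=
      ((hd.mono hdisj).differentiableAt (isOpen_ball.mem_nhds (mem_ball_self hdpos))).hasDerivAt
    have hF' : HasDerivAt (fun t : ℝ => F (z + t)) (deriv F z) 0 := by
      have h1 : HasDerivAt (fun t : ℝ => z + (t : ℂ)) 1 0 :=
        (HasDerivAt.ofReal_comp (hasDerivAt_id (0 : ℝ))).const_add z
      have h2 : HasDerivAt F (deriv F z) (z + ((0 : ℝ) : ℂ)) := by simpa using hF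
      have h3 := h2.comp (0 : ℝ) h1
      rw [mul_one] at h3
      exact h3
    rw [hzd.unique hF']
    rw [deriv_sub_const] at hbound
    refine hbound.trans (le_of_eq ?_)
    field_simp

end GMonogenic

/-! ### Looman–Menchoff theorem: Morera for bounded partial derivatives, and the Baire argument -/

namespace GMonogenic

open MeasureTheory Complex Metric

/-- A continuous function whose partial derivatives exist everywhere, are bounded and satisfy the
Cauchy–Riemann equation has vanishing integrals over the boundaries of rectangles. -/
theorem isConservativeOn_of_bounded_partial {w₀ : ℂ} {r C : ℝ} {F d : ℂ → ℂ}
    (hc : ContinuousOn F (ball w₀ r))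
    (hre : ∀ z ∈ ball w₀ r, HasDerivAt (fun t : ℝ => F (z + t)) (d z) 0)
    (him : ∀ z ∈ ball w₀ r, HasDerivAt (fun t : ℝ => F (z + t * I)) (I * d z) 0)
    (hC : ∀ z ∈ ball w₀ r, ‖d z‖ ≤ C) : IsConservativeOn F (ball w₀ r) := by
  intro z w hzw
  have hC0 : 0 ≤ C := (norm_nonneg _).trans (hC z (hzw (by simp [Rectangle, mem_reProdIm])))
  set D : ℂ → ℂ := (ball w₀ r).indicator d with hD
  -- The derivative is a pointwise limit of difference quotients with steps `1 / (m + 1)`;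
  -- measurability and the bound `C` are all that the fundamental theorem of calculus and Fubini
  -- require.
  have hDm : Measurable D := by
    have hFm : Measurable ((ball w₀ r).indicator F) := by
      classical
      rw [← Set.piecewise_eq_indicator]
      exact hc.measurable_piecewise continuousOn_const measurableSet_ball
    refine measurable_of_tendsto_metrizable (f := fun (m : ℕ) => (ball w₀ r).indicator fun z =>
      ((1 / ((m : ℝ) + 1) : ℝ) : ℂ)⁻¹ * ((ball w₀ r).indicator F (z + ((1 / ((m : ℝ) + 1) : ℝ) : ℂ))
        - (ball w₀ r).indicator F z)) (fun m => ?_) ?_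
    · refine Measurable.indicator ?_ measurableSet_ball
      exact ((hFm.comp (measurable_id.add_const _)).sub hFm).const_mul _
    · rw [tendsto_pi_nhds]
      intro y
      by_cases hy : y ∈ ball w₀ r
      · simp only [hD, Set.indicator_of_mem hy]
        have h1 := (hre y hy).tendsto_slope_zero
        have h2 : Filter.Tendsto (fun m : ℕ => 1 / ((m : ℝ) + 1)) Filter.atTop (𝓝[≠] 0) :=
          tendsto_nhdsWithin_iff.2 ⟨tendsto_one_div_add_atTop_nhds_zero_nat,
            Filter.Eventually.of_forall fun m => by
              simp only [Set.mem_compl_iff, Set.mem_singleton_iff]; positivity⟩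
        refine (h1.comp h2).congr' ?_
        have h3 : Filter.Tendsto (fun m : ℕ => y + ((1 / ((m : ℝ) + 1) : ℝ) : ℂ)) Filter.atTop
            (𝓝 (y + ((0 : ℝ) : ℂ))) :=
          ((continuous_ofReal.tendsto 0).comp tendsto_one_div_add_atTop_nhds_zero_nat).const_add y
        rw [ofReal_zero, add_zero] at h3
        filter_upwards [h3.eventually_mem (isOpen_ball.mem_nhds hy)] with m hm
        rw [Set.indicator_of_mem hm]
        simp
      · simp only [hD, Set.indicator_of_notMem hy]
        exact tendsto_const_nhds
  have hDb : ∀ y, ‖D y‖ ≤ C := fun y => by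
    by_cases hy : y ∈ ball w₀ r
    · simpa [hD, hy] using hC y hy
    · simpa [hD, hy] using hC0
  have hline : ∀ (y : ℝ), Measurable fun x : ℝ => D (x + y * I) := fun y =>
    hDm.comp (by fun_prop)
  have hline' : ∀ (x : ℝ), Measurable fun y : ℝ => D (x + y * I) := fun y =>
    hDm.comp (by fun_prop)
  have hint : ∀ {g : ℝ → ℂ} (a b : ℝ), Measurable g → (∀ x, ‖g x‖ ≤ C) →
      IntervalIntegrable g volume a b := fun a b hg hgC =>
    (intervalIntegrable_const (c := C)).mono_fun hg.aestronglyMeasurable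
      (Filter.Eventually.of_forall fun x => (hgC x).trans (le_abs_self C))
  have hmem : ∀ x ∈ Set.uIcc z.re w.re, ∀ y ∈ Set.uIcc z.im w.im,
      (x + y * I : ℂ) ∈ ball w₀ r := fun x hx y hy => hzw (by simp [Rectangle, mem_reProdIm, hx, hy])
  have H : ∀ y ∈ Set.uIcc z.im w.im,
      ∫ x in z.re..w.re, D (x + y * I) = F (w.re + y * I) - F (z.re + y * I) := by
    intro y hy
    refine intervalIntegral.integral_eq_sub_of_hasDerivAt (f := fun x : ℝ => F (x + y * I))
      (fun x hx => ?_) (hint _ _ (hline y) fun x => hDb _)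
    have h1 := hre _ (hmem x hx y hy)
    rw [hD, Set.indicator_of_mem (hmem x hx y hy)]
    have h2 : HasDerivAt (fun t : ℝ => F (x + y * I + t)) (d (x + y * I)) (x - x) := by simpa using h1
    refine (h2.comp_sub_const x x).congr_of_eventuallyEq (Filter.Eventually.of_forall fun t => ?_)
    simp only [ofReal_sub]
    congr 1
    ring
  have V : ∀ x ∈ Set.uIcc z.re w.re,
      ∫ y in z.im..w.im, I * D (x + y * I) = F (x + w.im * I) - F (x + z.im * I) := by
    intro x hx
    refine intervalIntegral.integral_eq_sub_of_hasDerivAt (f := fun y : ℝ => F (x + y * I))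
      (fun y hy => ?_) ((hint _ _ (hline' x) fun x => hDb _).const_mul I)
    have h1 := him _ (hmem x hx y hy)
    rw [hD, Set.indicator_of_mem (hmem x hx y hy)]
    have h2 : HasDerivAt (fun t : ℝ => F (x + y * I + t * I)) (I * d (x + y * I)) (y - y) := by
      simpa using h1
    refine (h2.comp_sub_const y y).congr_of_eventuallyEq (Filter.Eventually.of_forall fun t => ?_)
    simp only [ofReal_sub]
    congr 1
    ring
  have hFx : ∀ y ∈ Set.uIcc z.im w.im,
      IntervalIntegrable (fun x : ℝ => F (x + y * I)) volume z.re w.re := fun y hy =>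
    (hc.comp (Continuous.continuousOn (by fun_prop)) fun x hx => hmem x hx y hy).intervalIntegrable
  have hFy : ∀ x ∈ Set.uIcc z.re w.re,
      IntervalIntegrable (fun y : ℝ => F (x + y * I)) volume z.im w.im := fun x hx =>
    (hc.comp (Continuous.continuousOn (by fun_prop)) fun y hy => hmem x hx y hy).intervalIntegrable
  have swap : ∫ x in z.re..w.re, ∫ y in z.im..w.im, D (x + y * I) =
      ∫ y in z.im..w.im, ∫ x in z.re..w.re, D (x + y * I) := by
    refine intervalIntegral_intervalIntegral_swap (F := fun x y : ℝ => D (x + y * I)) ?_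
    refine Integrable.mono' (g := fun _ => C) ?_ ?_ (Filter.Eventually.of_forall fun p => hDb _)
    · exact (integrableOn_const_iff).2 (Or.inr (by
        rw [Measure.volume_eq_prod, Measure.prod_prod]
        exact ENNReal.mul_lt_top (by simp) (by simp)))
    · exact (hDm.comp (by fun_prop)).aestronglyMeasurable
  -- The horizontal sides contribute `-I` times the double integral of `D` and the vertical sides
  -- `I` times it, in the other order of integration.
  rw [← add_eq_zero_iff_eq_neg, wedgeIntegral_add_wedgeIntegral_eq, add_sub_assoc, ← smul_sub,
    ← intervalIntegral.integral_sub (hFx _ Set.left_mem_uIcc) (hFx _ Set.right_mem_uIcc),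
    ← intervalIntegral.integral_sub]
  · have e1 : ∫ x in z.re..w.re, (F (x + z.im * I) - F (x + w.im * I)) =
        -(I * ∫ x in z.re..w.re, ∫ y in z.im..w.im, D (x + y * I)) := by
      rw [← intervalIntegral.integral_const_mul, ← intervalIntegral.integral_neg]
      refine intervalIntegral.integral_congr fun x hx => ?_
      rw [← intervalIntegral.integral_const_mul, V x hx]
      ring
    rw [e1, ← intervalIntegral.integral_congr H, swap, smul_eq_mul]
    ring
  · exact hFy _ Set.right_mem_uIcc
  · exact hFy _ Set.left_mem_uIcc

/-- **Looman–Menchoff theorem**: a continuous function whose partial derivatives exist everywhere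
and satisfy the Cauchy–Riemann equation is holomorphic. -/
theorem differentiableOn_of_partial {U : Set ℂ} (hU : IsOpen U) {F d : ℂ → ℂ}
    (hc : ContinuousOn F U)
    (hre : ∀ z ∈ U, HasDerivAt (fun t : ℝ => F (z + t)) (d z) 0)
    (him : ∀ z ∈ U, HasDerivAt (fun t : ℝ => F (z + t * I)) (I * d z) 0) :
    DifferentiableOn ℂ F U := by
  set S : Set ℂ := {z | AnalyticAt ℂ F z}ᶜ with hSdef
  have hS : IsClosed S := (isOpen_analyticAt ℂ F).isClosed_compl
  suffices h : ∀ z ∈ U, z ∉ S from fun z hz =>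
    (not_not.1 (h z hz) : AnalyticAt ℂ F z).differentiableAt.differentiableWithinAt
  intro z₁ hz₁ hz₁S
  obtain ⟨R, hR, hRU⟩ := nhds_basis_closedBall.mem_iff.1 (hU.mem_nhds hz₁)
  -- Closing up after intersecting with the open ball ensures that every nonempty relatively open
  -- part of `K` contains a point of `S` inside that ball, near which all of `S` belongs to `K`.
  set K : Set ℂ := closure (ball z₁ R ∩ S) with hK
  have hKS : K ⊆ S := closure_minimal Set.inter_subset_right hS
  have hKR : K ⊆ closedBall z₁ R :=
    closure_minimal (Set.inter_subset_left.trans ball_subset_closedBall) isClosed_closedBall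
  have hKc : IsCompact K := (isCompact_closedBall z₁ R).of_isClosed_subset isClosed_closure hKR
  obtain ⟨δ, hδ, hδU⟩ := hKc.exists_cthickening_subset_open hU (hKR.trans hRU)
  obtain ⟨M, hM⟩ := hKc.cthickening.exists_bound_of_continuousOn (hc.mono hδU)
  have hthick : ∀ w ∈ K, ∀ x : ℂ, ‖x‖ ≤ δ → w + x ∈ cthickening δ K := fun w hw x hx =>
    mem_cthickening_of_dist_le _ w _ _ hw (by simpa [dist_eq_norm] using hx)
  -- Growth along both axes with constant `n`, over the fixed range `|t| ≤ δ`: closed conditions by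
  -- continuity of `F`, and they exhaust `K` because both partial derivatives exist at each point.
  let A : ℕ → Set K := fun n => {w | ∀ t : ℝ, |t| ≤ δ →
    ‖F (w + t) - F w‖ ≤ n * |t| ∧ ‖F (w + t * I) - F w‖ ≤ n * |t|}
  have hcontK : ∀ x : ℂ, ‖x‖ ≤ δ → Continuous fun w : K => F (w + x) := fun x hx =>
    (hc.mono hδU).comp_continuous (by fun_prop) fun w => hthick w w.2 x hx
  have hA : ∀ n, IsClosed (A n) := by
    intro n
    simp only [A, Set.ofPred_forall]
    refine isClosed_iInter fun t => isClosed_iInter fun ht => ?_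
    have h0 : Continuous fun w : K => F w := by simpa using hcontK 0 (by simpa using hδ.le)
    exact (isClosed_le ((hcontK t (by simpa using ht)).sub h0).norm continuous_const).inter
      (isClosed_le ((hcontK (t * I) (by simpa using ht)).sub h0).norm continuous_const)
  have growth : ∀ (w : K) (c e : ℂ), ‖c‖ = 1 → HasDerivAt (fun t : ℝ => F (w + t * c)) e 0 →
      ∃ B : ℝ, ∀ t : ℝ, |t| ≤ δ → ‖F (w + t * c) - F w‖ ≤ B * |t| := by
    intro w c e hcn he
    have h1 := he.hasFDerivAt.isBigO_sub.bound
    obtain ⟨B, hB⟩ := h1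
    obtain ⟨η, hη, hηB⟩ := Metric.eventually_nhds_iff.1 hB
    refine ⟨max B (2 * M / η), fun t ht => ?_⟩
    by_cases htη : |t| < η
    · have := hηB (y := t) (by simpa using htη)
      simp only [ofReal_zero, zero_mul, add_zero, sub_zero, Real.norm_eq_abs] at this
      exact this.trans (mul_le_mul_of_nonneg_right (le_max_left _ _) (abs_nonneg _))
    · push Not at htη
      have hM0 : 0 ≤ M := (norm_nonneg _).trans (hM w (by simpa using hthick w w.2 0 (by simpa using hδ.le)))
      calc ‖F (w + t * c) - F w‖ ≤ M + M := (norm_sub_le _ _).trans (add_le_add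
            (hM _ (hthick w w.2 _ (by simpa [hcn] using ht)))
            (hM _ (by simpa using hthick w w.2 0 (by simpa using hδ.le))))
        _ = 2 * M / η * η := by field_simp; ring
        _ ≤ 2 * M / η * |t| := by gcongr
        _ ≤ _ := mul_le_mul_of_nonneg_right (le_max_right _ _) (abs_nonneg _)
  have hAU : ⋃ n, A n = Set.univ := by
    refine Set.eq_univ_of_forall fun w => ?_
    have hwU : (w : ℂ) ∈ U := hRU (hKR w.2)
    obtain ⟨B₁, h₁⟩ := growth w 1 (d w) (by simp) (by simpa using hre w hwU)
    obtain ⟨B₂, h₂⟩ := growth w I (I * d w) (by simp) (him w hwU)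
    obtain ⟨n, hn⟩ := exists_nat_ge (max B₁ B₂)
    refine Set.mem_iUnion.2 ⟨n, fun t ht => ⟨?_, ?_⟩⟩
    · have := h₁ t ht
      rw [mul_one] at this
      exact this.trans (mul_le_mul_of_nonneg_right ((le_max_left _ _).trans hn) (abs_nonneg _))
    · exact (h₂ t ht).trans
        (mul_le_mul_of_nonneg_right ((le_max_right _ _).trans hn) (abs_nonneg _))
  have hz₁K : z₁ ∈ K := subset_closure ⟨mem_ball_self hR, hz₁S⟩
  have : Nonempty K := ⟨⟨z₁, hz₁K⟩⟩
  have : CompactSpace K := isCompact_iff_compactSpace.1 hKc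
  -- Baire's theorem in the compact space `K`: one constant `n` works on a whole portion of `K`.
  obtain ⟨n, w₁, hw₁⟩ := nonempty_interior_of_iUnion_of_closed hA hAU
  obtain ⟨O, hO, hOA⟩ := isOpen_induced_iff.1 (isOpen_interior (s := A n))
  have hw₁O : (w₁ : ℂ) ∈ O := by rwa [← hOA] at hw₁
  obtain ⟨w₀, hw₀O, hw₀R, hw₀S⟩ := mem_closure_iff.1 w₁.2 O hO hw₁O
  obtain ⟨r₀, hr₀, hr₀O⟩ := nhds_basis_closedBall.mem_iff.1
    ((hO.inter isOpen_ball).mem_nhds ⟨hw₀O, hw₀R⟩)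
  -- With `2 * r ≤ δ`, any two points of the ball are within the range of the axis estimates.
  set r := min r₀ (δ / 2) with hr
  have hrpos : 0 < r := by positivity
  have hrδ : 2 * r ≤ δ := by linarith [min_le_right r₀ (δ / 2)]
  have hrO : closedBall w₀ r ⊆ O ∩ ball z₁ R :=
    (closedBall_subset_closedBall (min_le_left _ _)).trans hr₀O
  have hrU : closedBall w₀ r ⊆ U := fun z hz => hRU (ball_subset_closedBall (hrO hz).2)
  have hbd : ∀ w ∈ S ∩ ball w₀ r, ∀ t : ℝ, |t| ≤ δ →
      ‖F (w + t) - F w‖ ≤ n * |t| ∧ ‖F (w + t * I) - F w‖ ≤ n * |t| := by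
    intro w hw
    have hw' := hrO (ball_subset_closedBall hw.2)
    have hwK : w ∈ K := subset_closure ⟨hw'.2, hw.1⟩
    have : (⟨w, hwK⟩ : K) ∈ interior (A n) := by rw [← hOA]; exact hw'.1
    exact interior_subset this
  have hdist : ∀ w ∈ ball w₀ r, ∀ z ∈ ball w₀ r, ‖z - w‖ ≤ δ := by
    intro w hw z hz
    have := dist_triangle_right z w w₀
    rw [mem_ball] at hw hz
    rw [← dist_eq_norm]
    linarith
  obtain ⟨M', hM'⟩ := (isCompact_closedBall w₀ r).exists_bound_of_continuousOn (hc.mono hrU)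
  have hdiff : DifferentiableOn ℂ F (ball w₀ r \ S) := fun z hz =>
    (not_not.1 hz.2 : AnalyticAt ℂ F z).differentiableAt.differentiableWithinAt
  -- The factor `2` comes from joining two points of `S` by a horizontal leg from one and a vertical
  -- leg from the other; each leg starts in `S`, so the corner need not lie there.
  obtain ⟨C, hC0, hC⟩ := exists_norm_sub_le_of_axes (n := 2 * n) hrpos (by positivity) hS
    (hc.mono hrU) hdiff hM' (by
      intro w hw z hz h
      have hzw : (n : ℝ) * ‖z - w‖ ≤ 2 * n * ‖z - w‖ := by gcongr; linarith [(n.cast_nonneg : (0 : ℝ) ≤ n)]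
      refine le_trans ?_ hzw
      rcases h with h | h
      · have h1 : z = w + ((z.im - w.im : ℝ) : ℂ) * I := by
          apply Complex.ext <;> simp [h]
        have h2 : |z.im - w.im| = ‖z - w‖ := by
          conv_rhs => rw [h1, add_sub_cancel_left, norm_mul, norm_I, mul_one, norm_real,
            Real.norm_eq_abs]
        have h3 := (hbd w hw (z.im - w.im) (h2 ▸ hdist w hw.2 z hz)).2
        rwa [← h1, h2] at h3
      · have h1 : z = w + ((z.re - w.re : ℝ) : ℂ) := by
          apply Complex.ext <;> simp [h]
        have h2 : |z.re - w.re| = ‖z - w‖ := by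
          conv_rhs => rw [h1, add_sub_cancel_left, norm_real, Real.norm_eq_abs]
        have h3 := (hbd w hw (z.re - w.re) (h2 ▸ hdist w hw.2 z hz)).1
        rwa [← h1, h2] at h3) (by
      intro w hw z hz
      have hre' : |z.re - w.re| ≤ ‖z - w‖ := by simpa using abs_re_le_norm (z - w)
      have him' : |z.im - w.im| ≤ ‖z - w‖ := by simpa using abs_im_le_norm (z - w)
      have h0 := hdist w hw.2 z hz.2
      have h1 := (hbd w hw (z.re - w.re) (hre'.trans h0)).1
      have h2 := (hbd z hz (-(z.im - w.im)) (by rw [abs_neg]; exact him'.trans h0)).2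
      have h3 : w + ((z.re - w.re : ℝ) : ℂ) = z + ((-(z.im - w.im) : ℝ) : ℂ) * I := by
        apply Complex.ext <;> simp
      rw [abs_neg, norm_sub_rev, ← h3] at h2
      calc ‖F z - F w‖ = ‖(F z - F (w + ((z.re - w.re : ℝ) : ℂ))) +
            (F (w + ((z.re - w.re : ℝ) : ℂ)) - F w)‖ := by congr 1; ring
        _ ≤ n * |z.im - w.im| + n * |z.re - w.re| := (norm_add_le _ _).trans (add_le_add h2 h1)
        _ ≤ n * ‖z - w‖ + n * ‖z - w‖ := by gcongr
        _ = _ := by ring)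
  have hbr : ball w₀ r ⊆ U := ball_subset_closedBall.trans hrU
  have hsub : ball w₀ (r / 4) ⊆ U := (ball_subset_ball (by linarith)).trans hbr
  have hcons : IsConservativeOn F (ball w₀ (r / 4)) :=
    isConservativeOn_of_bounded_partial (hc.mono hsub) (fun z hz => hre z (hsub hz))
      (fun z hz => him z (hsub hz)) fun z hz =>
        norm_deriv_le_of_linear_growth hS hw₀S (hc.mono hbr) hdiff hC hC0 hz (hre z (hsub hz))
  -- Morera makes `F` analytic at `w₀`, which was chosen in `S`.
  have hana := (hcons.isExactOn_ball (hc.mono hsub)).differentiableOn isOpen_ball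
  exact hw₀S (hana.analyticAt (isOpen_ball.mem_nhds (mem_ball_self (by positivity))))

end GMonogenic

/-! ### Existence and stability of Riemann–Stieltjes integrals -/

namespace GMonogenic

open MeasureTheory Metric

theorem sum_norm_sub_le_variation {E : Type*} [NormedAddCommGroup E] {g : ℝ → E}
    (hg : BoundedVariationOn g (Set.Icc 0 1)) {n : ℕ} {t : ℕ → ℝ} (ht : Monotone t) (h0 : t 0 = 0)
    (h1 : t n = 1) :
    ∑ i ∈ Finset.range n, ‖g (t (i + 1)) - g (t i)‖ ≤ (eVariationOn g (Set.Icc 0 1)).toReal := by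
  have h := eVariationOn.sum_le_of_monotoneOn_Iic (f := g) (s := Set.Icc 0 1) (n := n)
    (ht.monotoneOn _) fun i hi => ⟨h0 ▸ ht (Nat.zero_le i), h1 ▸ ht hi⟩
  have h2 := ENNReal.toReal_mono hg h
  rw [ENNReal.toReal_sum fun i _ => edist_ne_top _ _] at h2
  simpa [edist_dist, dist_eq_norm] using h2

theorem abs_tagged_sum_sub_le {u v g : ℝ → ℝ} (hg : BoundedVariationOn g (Set.Icc 0 1)) {c : ℝ}
    (hc : ∀ x ∈ Set.Icc (0 : ℝ) 1, |u x - v x| ≤ c) {n : ℕ} {t s : ℕ → ℝ} (ht : Monotone t)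
    (h0 : t 0 = 0) (h1 : t n = 1) (hs : ∀ i < n, s i ∈ Set.Icc (t i) (t (i + 1))) :
    |∑ i ∈ Finset.range n, u (s i) * (g (t (i + 1)) - g (t i)) -
      ∑ i ∈ Finset.range n, v (s i) * (g (t (i + 1)) - g (t i))| ≤
      c * (eVariationOn g (Set.Icc 0 1)).toReal := by
  have hc0 : 0 ≤ c := (abs_nonneg _).trans (hc 0 (by simp))
  rw [← Finset.sum_sub_distrib]
  refine (Finset.abs_sum_le_sum_abs _ _).trans
    (le_trans ?_ (mul_le_mul_of_nonneg_left (sum_norm_sub_le_variation hg ht h0 h1) hc0))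
  rw [Finset.mul_sum]
  refine Finset.sum_le_sum fun i hi => ?_
  have hi' := Finset.mem_range.1 hi
  rw [← sub_mul, abs_mul, Real.norm_eq_abs]
  refine mul_le_mul_of_nonneg_right (hc _ ⟨?_, ?_⟩) (abs_nonneg _)
  · exact (h0 ▸ ht (Nat.zero_le i)).trans (hs i hi').1
  · exact (hs i hi').2.trans (h1 ▸ ht hi')

theorem uniform_partition {n : ℕ} (hn : n ≠ 0) :
    Monotone (fun i : ℕ => (i : ℝ) / n) ∧ ((0 : ℕ) : ℝ) / n = 0 ∧ (n : ℝ) / n = 1 ∧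
      ∀ i : ℕ, ((i + 1 : ℕ) : ℝ) / n - (i : ℝ) / n = 1 / n := by
  have hn' : (n : ℝ) ≠ 0 := Nat.cast_ne_zero.2 hn
  refine ⟨fun i j hij => by simp only; gcongr, by simp, div_self hn', fun i => ?_⟩
  push_cast
  ring

/-- Once existence is known, uniform partitions with left tags determine the value; all later
identifications of integrals use only these sums. -/
theorem HasStieltjesIntegral.tendsto_uniform {u g : ℝ → ℝ} {S : ℝ}
    (h : HasStieltjesIntegral u g S) :
    Filter.Tendsto (fun n : ℕ => ∑ i ∈ Finset.range n,
      u ((i : ℝ) / n) * (g (((i + 1 : ℕ) : ℝ) / n) - g ((i : ℝ) / n))) Filter.atTop (𝓝 S) := by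
  rw [Metric.tendsto_atTop]
  intro ε hε
  obtain ⟨δ, hδ, H⟩ := h ε hε
  obtain ⟨N, hN⟩ := exists_nat_gt (1 / δ)
  refine ⟨N + 1, fun n hn => ?_⟩
  have hn0 : n ≠ 0 := by omega
  have hnpos : (0 : ℝ) < n := Nat.cast_pos.2 (Nat.pos_of_ne_zero hn0)
  have hNn : (N : ℝ) ≤ n := Nat.cast_le.2 (by omega)
  obtain ⟨hm, h0, h1, hd⟩ := uniform_partition hn0
  refine H n (fun i => (i : ℝ) / n) (fun i => (i : ℝ) / n) hm h0 h1 (fun i _ => ?_)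
    fun i _ => ⟨le_rfl, hm (Nat.le_succ i)⟩
  rw [hd, div_lt_comm₀ hnpos hδ]
  linarith

/-- Makes the integral Lipschitz in the integrand for the sup norm, so that existence passes to
uniform limits. -/
theorem HasStieltjesIntegral.abs_sub_le {u v g : ℝ → ℝ} {S T : ℝ}
    (hS : HasStieltjesIntegral u g S) (hT : HasStieltjesIntegral v g T)
    (hg : BoundedVariationOn g (Set.Icc 0 1)) {c : ℝ}
    (hc : ∀ x ∈ Set.Icc (0 : ℝ) 1, |u x - v x| ≤ c) :
    |S - T| ≤ c * (eVariationOn g (Set.Icc 0 1)).toReal := by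
  refine le_of_tendsto (hS.tendsto_uniform.sub hT.tendsto_uniform).abs ?_
  filter_upwards [Filter.eventually_ne_atTop 0] with n hn
  obtain ⟨hm, h0, h1, -⟩ := uniform_partition hn
  exact abs_tagged_sum_sub_le (t := fun i => (i : ℝ) / n) (s := fun i => (i : ℝ) / n) hg hc hm h0 h1
    fun i _ => ⟨le_rfl, hm (Nat.le_succ i)⟩

/-- Integration by parts gives the Stieltjes integral of a continuously differentiable function
against a continuous one. -/
theorem hasStieltjesIntegral_of_hasDerivAt {u u' g : ℝ → ℝ} (hu : ∀ x, HasDerivAt u (u' x) x)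
    (hu' : Continuous u') (hg : ContinuousOn g (Set.Icc 0 1)) :
    HasStieltjesIntegral u g (u 1 * g 1 - u 0 * g 0 - ∫ x in (0 : ℝ)..1, g x * u' x) := by
  intro ε hε
  obtain ⟨M, hM⟩ := (isCompact_Icc (a := (0 : ℝ)) (b := 1)).exists_bound_of_continuousOn
    hu'.continuousOn
  have hM0 : 0 ≤ M := (norm_nonneg _).trans (hM 0 (by simp))
  have huc := isCompact_Icc.uniformContinuousOn_of_continuous hg
  obtain ⟨δ, hδ, H⟩ := Metric.uniformContinuousOn_iff.1 huc (ε / (2 * (M + 1))) (by positivity)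
  refine ⟨δ, hδ, fun n t s ht h0 h1 hmesh hs => ?_⟩
  have hmem : ∀ i ≤ n, t i ∈ Set.Icc (0 : ℝ) 1 := fun i hi =>
    ⟨h0 ▸ ht (Nat.zero_le i), h1 ▸ ht hi⟩
  have hint : ∀ (c : ℝ) {a b : ℝ}, a ∈ Set.Icc (0 : ℝ) 1 → b ∈ Set.Icc (0 : ℝ) 1 →
      IntervalIntegrable (fun x => (g x - c) * u' x) volume a b := fun c a b ha hb =>
    (((hg.mono (Set.uIcc_subset_Icc ha hb)).sub continuousOn_const).mul
      hu'.continuousOn).intervalIntegrable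
  have hint0 : ∀ {a b : ℝ}, a ∈ Set.Icc (0 : ℝ) 1 → b ∈ Set.Icc (0 : ℝ) 1 →
      IntervalIntegrable (fun x => g x * u' x) volume a b := fun ha hb => by
    simpa using hint 0 ha hb
  have hftc : ∀ a b, ∫ x in a..b, u' x = u b - u a := fun a b =>
    intervalIntegral.integral_eq_sub_of_hasDerivAt (fun x _ => hu x) (hu'.intervalIntegrable a b)
  have hsub : ∀ (c : ℝ) {a b : ℝ}, a ∈ Set.Icc (0 : ℝ) 1 → b ∈ Set.Icc (0 : ℝ) 1 →
      ∫ x in a..b, (g x - c) * u' x = (∫ x in a..b, g x * u' x) - c * (u b - u a) := by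
    intro c a b ha hb
    rw [← hftc, ← intervalIntegral.integral_const_mul, ← intervalIntegral.integral_sub (hint0 ha hb)
      ((hu'.intervalIntegrable a b).const_mul c)]
    exact intervalIntegral.integral_congr fun x _ => by ring
  -- Integrating by parts on each side of the tag `s i` turns the cell error into integrals of `u'`
  -- against the oscillation of `g`, which is small by uniform continuity.
  have cell : ∀ i < n, |u (s i) * (g (t (i + 1)) - g (t i)) - (u (t (i + 1)) * g (t (i + 1)) -
      u (t i) * g (t i)) + ∫ x in t i..t (i + 1), g x * u' x| ≤
      ε / (2 * (M + 1)) * M * (t (i + 1) - t i) := by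
    intro i hi
    have ha := hmem i hi.le
    have hb := hmem (i + 1) hi
    have hsi := hs i hi
    have hs01 : s i ∈ Set.Icc (0 : ℝ) 1 := ⟨ha.1.trans hsi.1, hsi.2.trans hb.2⟩
    have hm := hmesh i hi
    have e : u (s i) * (g (t (i + 1)) - g (t i)) - (u (t (i + 1)) * g (t (i + 1)) -
        u (t i) * g (t i)) + ∫ x in t i..t (i + 1), g x * u' x =
        (∫ x in t i..s i, (g x - g (t i)) * u' x) +
          ∫ x in s i..t (i + 1), (g x - g (t (i + 1))) * u' x := by
      rw [hsub _ ha hs01, hsub _ hs01 hb,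
        ← intervalIntegral.integral_add_adjacent_intervals (hint0 ha hs01) (hint0 hs01 hb)]
      ring
    have hb1 := intervalIntegral.norm_integral_le_of_norm_le_const
      (f := fun x => (g x - g (t i)) * u' x) (a := t i) (b := s i) (C := ε / (2 * (M + 1)) * M) (by
        intro x hx
        rw [Set.uIoc_of_le hsi.1] at hx
        have hx01 : x ∈ Set.Icc (0 : ℝ) 1 := ⟨ha.1.trans hx.1.le, hx.2.trans hs01.2⟩
        rw [norm_mul]
        refine mul_le_mul ?_ (hM x hx01) (norm_nonneg _) (by positivity)
        rw [← dist_eq_norm]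
        refine (H x hx01 _ ha ?_).le
        rw [Real.dist_eq, abs_lt]
        constructor <;> linarith [hx.1, hx.2, hsi.2])
    have hb2 := intervalIntegral.norm_integral_le_of_norm_le_const
      (f := fun x => (g x - g (t (i + 1))) * u' x) (a := s i) (b := t (i + 1))
      (C := ε / (2 * (M + 1)) * M) (by
        intro x hx
        rw [Set.uIoc_of_le hsi.2] at hx
        have hx01 : x ∈ Set.Icc (0 : ℝ) 1 := ⟨hs01.1.trans hx.1.le, hx.2.trans hb.2⟩
        rw [norm_mul]
        refine mul_le_mul ?_ (hM x hx01) (norm_nonneg _) (by positivity)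
        rw [← dist_eq_norm]
        refine (H x hx01 _ hb ?_).le
        rw [Real.dist_eq, abs_lt]
        constructor <;> linarith [hx.1, hx.2, hsi.1])
    rw [abs_of_nonneg (sub_nonneg.2 hsi.1)] at hb1
    rw [abs_of_nonneg (sub_nonneg.2 hsi.2)] at hb2
    rw [e, ← Real.norm_eq_abs]
    refine (norm_add_le _ _).trans ((add_le_add hb1 hb2).trans (le_of_eq ?_))
    ring
  have htel : ∑ i ∈ Finset.range n, (u (t (i + 1)) * g (t (i + 1)) - u (t i) * g (t i)) =
      u 1 * g 1 - u 0 * g 0 := by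
    rw [Finset.sum_range_sub (fun i => u (t i) * g (t i)), h0, h1]
  have hadj : ∑ i ∈ Finset.range n, ∫ x in t i..t (i + 1), g x * u' x =
      ∫ x in (0 : ℝ)..1, g x * u' x := by
    rw [intervalIntegral.sum_integral_adjacent_intervals fun i hi =>
      hint0 (hmem i hi.le) (hmem (i + 1) hi), h0, h1]
  have hlen : ∑ i ∈ Finset.range n, (t (i + 1) - t i) = 1 := by
    rw [Finset.sum_range_sub, h0, h1, sub_zero]
  rw [← htel, ← hadj, ← Finset.sum_sub_distrib, ← Finset.sum_sub_distrib]
  calc _ ≤ ∑ i ∈ Finset.range n, ε / (2 * (M + 1)) * M * (t (i + 1) - t i) := by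
        refine (Finset.abs_sum_le_sum_abs _ _).trans (Finset.sum_le_sum fun i hi => ?_)
        refine le_of_eq_of_le (congrArg abs ?_) (cell i (Finset.mem_range.1 hi))
        ring
    _ = ε / (2 * (M + 1)) * M := by rw [← Finset.mul_sum, hlen, mul_one]
    _ < ε := by
        rw [div_mul_eq_mul_div, div_lt_iff₀ (by positivity)]
        nlinarith

/-- The Stieltjes integral of a continuous function against a continuous function of bounded
variation exists. -/
theorem exists_hasStieltjesIntegral {u g : ℝ → ℝ} (hu : ContinuousOn u (Set.Icc 0 1))
    (hg : ContinuousOn g (Set.Icc 0 1)) (hgv : BoundedVariationOn g (Set.Icc 0 1)) :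
    ∃ S, HasStieltjesIntegral u g S := by
  set V := (eVariationOn g (Set.Icc 0 1)).toReal with hV
  have hV0 : 0 ≤ V := ENNReal.toReal_nonneg
  -- Weierstrass approximation reduces the integrand to polynomials, for which integration by parts
  -- gives the integral.
  have hp : ∀ k : ℕ, ∃ p : Polynomial ℝ, ∀ x ∈ Set.Icc (0 : ℝ) 1, |p.eval x - u x| < 1 / (k + 1) :=
    fun k => exists_polynomial_near_of_continuousOn 0 1 u hu _ (by positivity)
  choose p hp using hp
  have hS : ∀ k, ∃ S, HasStieltjesIntegral (fun x => (p k).eval x) g S := fun k =>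
    ⟨_, hasStieltjesIntegral_of_hasDerivAt (fun x => (p k).hasDerivAt x)
      (p k).derivative.continuous hg⟩
  choose S hS using hS
  have hcau : CauchySeq S := by
    refine cauchySeq_of_le_tendsto_0 (fun k : ℕ => 2 * (1 / ((k : ℝ) + 1)) * V) (fun k l N hk hl => ?_) ?_
    · rw [Real.dist_eq]
      refine (hS k).abs_sub_le (hS l) hgv fun x hx => ?_
      have h1 := hp k x hx
      have h2 := hp l x hx
      have h3 : 1 / ((k : ℝ) + 1) ≤ 1 / ((N : ℝ) + 1) := by gcongr
      have h4 : 1 / ((l : ℝ) + 1) ≤ 1 / ((N : ℝ) + 1) := by gcongr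
      rw [abs_lt] at h1 h2
      rw [abs_le]
      constructor <;> linarith
    · simpa using (tendsto_one_div_add_atTop_nhds_zero_nat.const_mul 2).mul_const V
  obtain ⟨T, hT⟩ := cauchySeq_tendsto_of_complete hcau
  refine ⟨T, fun ε hε => ?_⟩
  have e1 : ∀ᶠ k in Filter.atTop, dist (S k) T < ε / 3 :=
    hT.eventually (Metric.ball_mem_nhds T (by positivity))
  have e2 : ∀ᶠ k : ℕ in Filter.atTop, 1 / ((k : ℝ) + 1) * V < ε / 3 := by
    have h := tendsto_one_div_add_atTop_nhds_zero_nat (𝕜 := ℝ).mul_const V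
    rw [zero_mul] at h
    exact h.eventually (gt_mem_nhds (by positivity))
  obtain ⟨k, hk1, hk2⟩ := (e1.and e2).exists
  obtain ⟨δ, hδ, H⟩ := hS k (ε / 3) (by positivity)
  refine ⟨δ, hδ, fun n t s ht h0 h1 hmesh hs => ?_⟩
  have h2 := H n t s ht h0 h1 hmesh hs
  have h3 := abs_tagged_sum_sub_le hgv (u := u) (v := fun x => (p k).eval x) (c := 1 / ((k : ℝ) + 1))
    (fun x hx => by rw [abs_sub_comm]; exact (hp k x hx).le) ht h0 h1 hs
  rw [Real.dist_eq] at hk1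
  have h4 := abs_add_three (∑ i ∈ Finset.range n, u (s i) * (g (t (i + 1)) - g (t i)) -
    ∑ i ∈ Finset.range n, (p k).eval (s i) * (g (t (i + 1)) - g (t i)))
    (∑ i ∈ Finset.range n, (p k).eval (s i) * (g (t (i + 1)) - g (t i)) - S k) (S k - T)
  rw [sub_add_sub_cancel, sub_add_sub_cancel] at h4
  linarith

end GMonogenic

/-! ### Polygon integrals: homotopy invariance and comparison with Stieltjes sums -/

namespace GMonogenic

open MeasureTheory Metric

/-- The integral of `f` along the segment from `a` to `b`. -/
noncomputable def segmentIntegral (f : ℂ → ℂ) (a b : ℂ) : ℂ :=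
  ∫ t in (0 : ℝ)..1, f (a + t * (b - a)) * (b - a)

/-- The integral of `f` along the polygon with the vertices `Γ (j / n)`, `j = 0, …, n`. -/
noncomputable def polygonIntegral (f : ℂ → ℂ) (Γ : ℝ → ℂ) (n : ℕ) : ℂ :=
  ∑ j ∈ Finset.range n, segmentIntegral f (Γ ((j : ℝ) / n)) (Γ (((j + 1 : ℕ) : ℝ) / n))

theorem segment_point_mem {a b : ℂ} {s : Set ℂ} (hs : Convex ℝ s) (ha : a ∈ s) (hb : b ∈ s) {t : ℝ}
    (ht : t ∈ Set.Icc (0 : ℝ) 1) : a + t * (b - a) ∈ s := by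
  simpa using hs.add_smul_sub_mem ha hb ht

theorem intervalIntegrable_segment {f : ℂ → ℂ} {s : Set ℂ} (hs : Convex ℝ s) {a b : ℂ}
    (hf : ContinuousOn f s) (ha : a ∈ s) (hb : b ∈ s) :
    IntervalIntegrable (fun t : ℝ => f (a + t * (b - a)) * (b - a)) volume 0 1 := by
  refine ContinuousOn.intervalIntegrable (ContinuousOn.mul ?_ continuousOn_const)
  refine hf.comp (Continuous.continuousOn (by fun_prop)) fun t ht => ?_
  rw [Set.uIcc_of_le zero_le_one] at ht
  exact segment_point_mem hs ha hb ht

theorem segmentIntegral_eq_sub {f G : ℂ → ℂ} {s : Set ℂ} (hs : Convex ℝ s)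
    (hf : ContinuousOn f s) (hG : ∀ z ∈ s, HasDerivAt G (f z) z) {a b : ℂ} (ha : a ∈ s)
    (hb : b ∈ s) : segmentIntegral f a b = G b - G a := by
  have h := intervalIntegral.integral_eq_sub_of_hasDerivAt (a := (0 : ℝ)) (b := 1)
    (f := fun t : ℝ => G (a + t * (b - a))) (f' := fun t : ℝ => f (a + t * (b - a)) * (b - a))
    (fun t ht => ?_) (intervalIntegrable_segment hs hf ha hb)
  · rw [segmentIntegral, h]
    simp
  · rw [Set.uIcc_of_le zero_le_one] at ht
    have h1 : HasDerivAt (fun t : ℝ => a + (t : ℂ) * (b - a)) (1 * (b - a)) t :=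
      ((HasDerivAt.ofReal_comp (hasDerivAt_id t)).mul_const (b - a)).const_add a
    rw [one_mul] at h1
    exact (hG _ (segment_point_mem hs ha hb ht)).comp t h1

theorem norm_mul_sub_segmentIntegral_le {f : ℂ → ℂ} {s : Set ℂ} (hs : Convex ℝ s)
    (hf : ContinuousOn f s) {a b : ℂ} (ha : a ∈ s) (hb : b ∈ s) {ε : ℝ}
    (hε : ∀ z ∈ s, ‖f a - f z‖ ≤ ε) :
    ‖f a * (b - a) - segmentIntegral f a b‖ ≤ ε * ‖b - a‖ := by
  have e : f a * (b - a) - segmentIntegral f a b =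
      ∫ t in (0 : ℝ)..1, (f a * (b - a) - f (a + t * (b - a)) * (b - a)) := by
    rw [intervalIntegral.integral_sub intervalIntegrable_const
      (intervalIntegrable_segment hs hf ha hb)]
    simp [segmentIntegral]
  rw [e]
  have h := intervalIntegral.norm_integral_le_of_norm_le_const (a := (0 : ℝ)) (b := 1)
    (f := fun t : ℝ => f a * (b - a) - f (a + t * (b - a)) * (b - a)) (C := ε * ‖b - a‖) ?_
  · simpa using h
  · intro t ht
    rw [Set.uIoc_of_le zero_le_one] at ht
    rw [← sub_mul, norm_mul]
    exact mul_le_mul_of_nonneg_right (hε _ (segment_point_mem hs ha hb ⟨ht.1.le, ht.2⟩))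
      (norm_nonneg _)

theorem exists_ball_subset_of_isCompact {K U : Set ℂ} (hK : IsCompact K) (hU : IsOpen U)
    (hKU : K ⊆ U) : ∃ δ > 0, ∀ z ∈ K, ball z δ ⊆ U := by
  obtain ⟨δ, hδ, h⟩ := hK.exists_thickening_subset_open hU hKU
  exact ⟨δ, hδ, fun z hz => (ball_subset_thickening hz δ).trans h⟩

theorem div_mem_Icc {n j : ℕ} (hj : j ≤ n) : (j : ℝ) / n ∈ Set.Icc (0 : ℝ) 1 :=
  ⟨by positivity, div_le_one_of_le₀ (Nat.cast_le.2 hj) (by positivity)⟩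

theorem eventually_one_div_lt {δ : ℝ} (hδ : 0 < δ) : ∀ᶠ n : ℕ in Filter.atTop, 1 / (n : ℝ) < δ :=
  (tendsto_one_div_atTop_nhds_zero_nat).eventually (gt_mem_nhds hδ)

/-- For fine partitions the polygon integral of a holomorphic function does not change under a
homotopy of closed curves. -/
theorem polygonIntegral_eq_of_homotopy {U : Set ℂ} (hU : IsOpen U) {f : ℂ → ℂ}
    (hf : DifferentiableOn ℂ f U) {H : ℝ × ℝ → ℂ}
    (hH : ContinuousOn H (Set.Icc 0 1 ×ˢ Set.Icc 0 1))
    (hHU : ∀ p ∈ Set.Icc (0 : ℝ) 1 ×ˢ Set.Icc (0 : ℝ) 1, H p ∈ U)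
    (hcl : ∀ s ∈ Set.Icc (0 : ℝ) 1, H (s, 0) = H (s, 1)) :
    ∀ᶠ n in Filter.atTop,
      polygonIntegral f (fun t => H (0, t)) n = polygonIntegral f (fun t => H (1, t)) n := by
  have hsq : IsCompact (Set.Icc (0 : ℝ) 1 ×ˢ Set.Icc (0 : ℝ) 1) := isCompact_Icc.prod isCompact_Icc
  obtain ⟨δ, hδ, hδU⟩ := exists_ball_subset_of_isCompact (hsq.image_of_continuousOn hH) hU
    (Set.image_subset_iff.2 hHU)
  obtain ⟨η, hη, huc⟩ := Metric.uniformContinuousOn_iff.1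
    (hsq.uniformContinuousOn_of_continuous hH) δ hδ
  filter_upwards [eventually_one_div_lt hη, Filter.eventually_ne_atTop 0] with n hn hn0
  obtain ⟨-, -, hn1, hstep⟩ := uniform_partition hn0
  set z : ℕ → ℕ → ℂ := fun i j => H ((i : ℝ) / n, (j : ℝ) / n) with hz
  have hmem : ∀ i ≤ n, ∀ j ≤ n, ((i : ℝ) / n, (j : ℝ) / n) ∈
      Set.Icc (0 : ℝ) 1 ×ˢ Set.Icc (0 : ℝ) 1 := fun i hi j hj =>
    ⟨div_mem_Icc hi, div_mem_Icc hj⟩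
  have hd : ∀ i : ℕ, dist (((i + 1 : ℕ) : ℝ) / n) ((i : ℝ) / n) < η := fun i => by
    rw [Real.dist_eq, hstep, abs_of_nonneg (by positivity)]
    exact hn
  -- All four corners lie in a disc inside `U`, where `f` has a primitive, so the integral around
  -- the cell vanishes. Summed over `j`, the transverse edges telescope and the end terms agree
  -- because the curves are closed.
  have cell : ∀ i < n, ∀ j < n,
      segmentIntegral f (z i j) (z i (j + 1)) - segmentIntegral f (z (i + 1) j) (z (i + 1) (j + 1)) =
        segmentIntegral f (z i j) (z (i + 1) j) -
          segmentIntegral f (z i (j + 1)) (z (i + 1) (j + 1)) := by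
    intro i hi j hj
    have hB : ball (z i j) δ ⊆ U := hδU _ (Set.mem_image_of_mem _ (hmem i hi.le j hj.le))
    obtain ⟨G, hG⟩ := (hf.mono hB).isExactOn_ball
    have h00 : z i j ∈ ball (z i j) δ := mem_ball_self hδ
    have h10 : z (i + 1) j ∈ ball (z i j) δ :=
      huc _ (hmem _ hi _ hj.le) _ (hmem _ hi.le _ hj.le) (by
        rw [Prod.dist_eq]; exact max_lt (hd i) (by simpa using hη))
    have h01 : z i (j + 1) ∈ ball (z i j) δ :=
      huc _ (hmem _ hi.le _ hj) _ (hmem _ hi.le _ hj.le) (by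
        rw [Prod.dist_eq]; exact max_lt (by simpa using hη) (hd j))
    have h11 : z (i + 1) (j + 1) ∈ ball (z i j) δ :=
      huc _ (hmem _ hi _ hj) _ (hmem _ hi.le _ hj.le) (by
        rw [Prod.dist_eq]; exact max_lt (hd i) (hd j))
    have hs := fun {a b : ℂ} => segmentIntegral_eq_sub (a := a) (b := b) (convex_ball (z i j) δ)
      (hf.mono hB).continuousOn hG
    rw [hs h00 h01, hs h10 h11, hs h00 h10, hs h01 h11]
    ring
  have row : ∀ i < n, ∑ j ∈ Finset.range n, segmentIntegral f (z i j) (z i (j + 1)) =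
      ∑ j ∈ Finset.range n, segmentIntegral f (z (i + 1) j) (z (i + 1) (j + 1)) := by
    intro i hi
    rw [← sub_eq_zero, ← Finset.sum_sub_distrib,
      Finset.sum_congr rfl fun j hj => cell i hi j (Finset.mem_range.1 hj),
      Finset.sum_range_sub' (fun j => segmentIntegral f (z i j) (z (i + 1) j))]
    have h0 : ∀ i ≤ n, z i n = z i 0 := fun i hi => by
      simp only [hz, hn1, Nat.cast_zero, zero_div]
      exact (hcl _ (div_mem_Icc hi)).symm
    rw [h0 i hi.le, h0 (i + 1) hi, sub_self]
  have all : ∀ i ≤ n, ∑ j ∈ Finset.range n, segmentIntegral f (z 0 j) (z 0 (j + 1)) =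
      ∑ j ∈ Finset.range n, segmentIntegral f (z i j) (z i (j + 1)) := by
    intro i
    induction i with
    | zero => intro _; rfl
    | succ i ih => intro hi; rw [ih (by omega), row i hi]
  have h := all n le_rfl
  simp only [hz, hn1, Nat.cast_zero, zero_div] at h
  exact h

/-- For fine partitions the polygon integral along a continuously differentiable curve is the
curve integral. -/
theorem polygonIntegral_eq_integral {U : Set ℂ} (hU : IsOpen U) {f : ℂ → ℂ}
    (hf : DifferentiableOn ℂ f U) {Γ Γ' : ℝ → ℂ} (hΓ : ∀ t, HasDerivAt Γ (Γ' t) t)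
    (hΓ' : Continuous Γ') (hΓU : ∀ t ∈ Set.Icc (0 : ℝ) 1, Γ t ∈ U) :
    ∀ᶠ n in Filter.atTop, polygonIntegral f Γ n = ∫ t in (0 : ℝ)..1, f (Γ t) * Γ' t := by
  have hc : Continuous Γ := continuous_iff_continuousAt.2 fun t => (hΓ t).continuousAt
  obtain ⟨δ, hδ, hδU⟩ := exists_ball_subset_of_isCompact (isCompact_Icc.image hc) hU
    (Set.image_subset_iff.2 hΓU)
  obtain ⟨η, hη, huc⟩ := Metric.uniformContinuousOn_iff.1
    (isCompact_Icc.uniformContinuousOn_of_continuous (hc.continuousOn (s := Set.Icc 0 1))) δ hδ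
  have hint : ∀ a ∈ Set.Icc (0 : ℝ) 1, ∀ b ∈ Set.Icc (0 : ℝ) 1,
      IntervalIntegrable (fun t => f (Γ t) * Γ' t) volume a b := fun a ha b hb =>
    ((hf.continuousOn.comp hc.continuousOn fun t ht => hΓU t (Set.uIcc_subset_Icc ha hb ht)).mul
      hΓ'.continuousOn).intervalIntegrable
  filter_upwards [eventually_one_div_lt hη, Filter.eventually_ne_atTop 0] with n hn hn0
  obtain ⟨hm, h0, h1, hstep⟩ := uniform_partition hn0
  have hadj := intervalIntegral.sum_integral_adjacent_intervals (μ := volume) (n := n)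
    (f := fun t => f (Γ t) * Γ' t) (a := fun i : ℕ => (i : ℝ) / n) fun i hi =>
      hint _ (div_mem_Icc hi.le) _ (div_mem_Icc hi)
  rw [h0, h1] at hadj
  rw [← hadj, polygonIntegral]
  refine Finset.sum_congr rfl fun j hj => ?_
  have hj := Finset.mem_range.1 hj
  have hB : ball (Γ ((j : ℝ) / n)) δ ⊆ U := hδU _ (Set.mem_image_of_mem _ (div_mem_Icc hj.le))
  obtain ⟨G, hG⟩ := (hf.mono hB).isExactOn_ball
  have hball : ∀ t ∈ Set.Icc ((j : ℝ) / n) (((j + 1 : ℕ) : ℝ) / n),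
      Γ t ∈ ball (Γ ((j : ℝ) / n)) δ := by
    intro t ht
    refine huc _ ⟨(div_mem_Icc hj.le).1.trans ht.1, ht.2.trans (div_mem_Icc hj).2⟩ _
      (div_mem_Icc hj.le) ?_
    rw [Real.dist_eq, abs_of_nonneg (sub_nonneg.2 ht.1)]
    linarith [ht.2, hstep j]
  have hle : (j : ℝ) / n ≤ ((j + 1 : ℕ) : ℝ) / n := hm (Nat.le_succ j)
  rw [segmentIntegral_eq_sub (convex_ball _ δ) (hf.mono hB).continuousOn hG (mem_ball_self hδ)
    (hball _ ⟨hle, le_rfl⟩)]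
  refine (intervalIntegral.integral_eq_sub_of_hasDerivAt (f := fun t => G (Γ t)) (fun t ht => ?_)
    (hint _ (div_mem_Icc hj.le) _ (div_mem_Icc hj))).symm
  rw [Set.uIcc_of_le hle] at ht
  exact (hG _ (hball t ht)).comp t (hΓ t)

/-- The polygon integrals and the Riemann–Stieltjes sums along a rectifiable curve have the same
limit. -/
theorem tendsto_sum_sub_polygonIntegral {U : Set ℂ} (hU : IsOpen U) {f : ℂ → ℂ}
    (hf : ContinuousOn f U) {Γ : ℝ → ℂ} (hΓ : ContinuousOn Γ (Set.Icc 0 1))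
    (hΓv : BoundedVariationOn Γ (Set.Icc 0 1)) (hΓU : ∀ t ∈ Set.Icc (0 : ℝ) 1, Γ t ∈ U) :
    Filter.Tendsto (fun n : ℕ => ∑ j ∈ Finset.range n,
      f (Γ ((j : ℝ) / n)) * (Γ (((j + 1 : ℕ) : ℝ) / n) - Γ ((j : ℝ) / n)) - polygonIntegral f Γ n)
      Filter.atTop (𝓝 0) := by
  set V := (eVariationOn Γ (Set.Icc 0 1)).toReal with hV
  have hV0 : 0 ≤ V := ENNReal.toReal_nonneg
  have hK := isCompact_Icc.image_of_continuousOn hΓ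
  -- Chords leave the curve, so uniform continuity of `f` is needed on a compact neighbourhood of
  -- it.
  obtain ⟨δ, hδ, hδU⟩ := hK.exists_cthickening_subset_open hU (Set.image_subset_iff.2 hΓU)
  have hfu := hK.cthickening.uniformContinuousOn_of_continuous (hf.mono hδU)
  rw [Metric.tendsto_nhds]
  intro ε hε
  obtain ⟨η, hη, hfη⟩ := Metric.uniformContinuousOn_iff.1 hfu (ε / (V + 1)) (by positivity)
  obtain ⟨θ, hθ, huc⟩ := Metric.uniformContinuousOn_iff.1
    (isCompact_Icc.uniformContinuousOn_of_continuous hΓ) (min η δ) (by positivity)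
  filter_upwards [eventually_one_div_lt hθ, Filter.eventually_ne_atTop 0] with n hn hn0
  obtain ⟨hm, h0, h1, hstep⟩ := uniform_partition hn0
  rw [dist_zero_right, polygonIntegral, ← Finset.sum_sub_distrib]
  have hvar := sum_norm_sub_le_variation hΓv (t := fun i : ℕ => (i : ℝ) / n) hm h0 h1
  calc _ ≤ ∑ j ∈ Finset.range n,
        ε / (V + 1) * ‖Γ (((j + 1 : ℕ) : ℝ) / n) - Γ ((j : ℝ) / n)‖ := by
        refine (norm_sum_le _ _).trans (Finset.sum_le_sum fun j hj => ?_)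
        have hj := Finset.mem_range.1 hj
        have hjK := Set.mem_image_of_mem Γ (div_mem_Icc hj.le)
        have hsub : ball (Γ ((j : ℝ) / n)) (min η δ) ⊆ cthickening δ (Γ '' Set.Icc 0 1) :=
          (ball_subset_ball (min_le_right _ _)).trans
            ((ball_subset_thickening hjK δ).trans (thickening_subset_cthickening _ _))
        refine norm_mul_sub_segmentIntegral_le (convex_ball (Γ ((j : ℝ) / n)) (min η δ))
          (hf.mono (hsub.trans hδU)) (mem_ball_self (by positivity)) ?_ fun z hz => ?_
        · refine huc _ (div_mem_Icc hj) _ (div_mem_Icc hj.le) ?_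
          rw [Real.dist_eq, hstep, abs_of_nonneg (by positivity)]
          exact hn
        · rw [← dist_eq_norm]
          refine (hfη _ (hsub (mem_ball_self (by positivity))) _ (hsub hz) ?_).le
          rw [dist_comm]
          exact lt_of_lt_of_le hz (min_le_left _ _)
    _ ≤ ε / (V + 1) * V := by
        rw [← Finset.mul_sum]
        gcongr
    _ < ε := by
        rw [div_mul_eq_mul_div, div_lt_iff₀ (by positivity)]
        nlinarith

end GMonogenic

/-! ### Factorization through a functional, and Cauchy's formula in the plane -/

namespace GMonogenic

open Metric Filter

section Factorization

variable {E : Type*} [NormedAddCommGroup E] [NormedSpace ℝ E]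

/-- A function whose one-sided derivatives in the directions of the kernel of `ξ` vanish takes equal
values at points of the same fibre of `ξ`. -/
theorem eq_of_segment_subset {ξ : E →L[ℝ] ℂ} {Ω : Set E} {U : E → ℂ} (hU : ContinuousOn U Ω)
    (hder : ∀ p ∈ Ω, ∃ d, ∀ h, Tendsto (fun ε : ℝ => ε⁻¹ • (U (p + ε • h) - U p)) (𝓝[>] 0)
      (𝓝 (ξ h * d)))
    {p q : E} (hpq : ξ p = ξ q) (hseg : segment ℝ p q ⊆ Ω) : U p = U q := by
  have hmem : ∀ t ∈ Set.Icc (0 : ℝ) 1, p + t • (q - p) ∈ Ω := fun t ht =>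
    hseg (by rw [segment_eq_image']; exact ⟨t, ht, rfl⟩)
  have h := constant_of_has_deriv_right_zero (f := fun t : ℝ => U (p + t • (q - p))) (a := 0) (b := 1)
    (hU.comp (Continuous.continuousOn (by fun_prop)) hmem) (fun x hx => ?_) 1 (by simp)
  · simpa using h.symm
  · obtain ⟨d, hd⟩ := hder _ (hmem x ⟨hx.1, hx.2.le⟩)
    have h1 := hd (q - p)
    rw [map_sub, hpq, sub_self, zero_mul] at h1
    refine HasDerivWithinAt.Ici_of_Ioi ((hasDerivWithinAt_iff_tendsto_slope' (by simp)).2 ?_)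
    have h2 : Tendsto (fun y : ℝ => y - x) (𝓝[>] x) (𝓝[>] 0) := by
      refine tendsto_nhdsWithin_iff.2 ⟨?_, ?_⟩
      · have : Tendsto (fun y : ℝ => y - x) (𝓝 x) (𝓝 (x - x)) :=
          Continuous.tendsto (by fun_prop) x
        rw [sub_self] at this
        exact this.mono_left nhdsWithin_le_nhds
      · filter_upwards [self_mem_nhdsWithin] with y hy
        exact sub_pos.2 (Set.mem_Ioi.1 hy)
    refine (h1.comp h2).congr fun y => ?_
    simp only [Function.comp, slope, vsub_eq_sub]
    rw [add_assoc, ← add_smul, add_sub_cancel]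

/-- Monogenicity gives only right-hand limits, but in the directions `h` and `-h` with the same
derivative; together they form a two-sided derivative. -/
theorem hasDerivAt_of_one_sided {g : ℝ → ℂ} {e : ℂ}
    (h₁ : Tendsto (fun ε : ℝ => ε⁻¹ • (g ε - g 0)) (𝓝[>] 0) (𝓝 e))
    (h₂ : Tendsto (fun ε : ℝ => ε⁻¹ • (g (-ε) - g 0)) (𝓝[>] 0) (𝓝 (-e))) : HasDerivAt g e 0 := by
  rw [hasDerivAt_iff_tendsto_slope_zero, ← Set.Iio_union_Ioi, nhdsWithin_union, tendsto_sup]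
  constructor
  · have h3 : Tendsto (fun ε : ℝ => -ε) (𝓝[<] 0) (𝓝[>] 0) := by
      simpa using tendsto_neg_nhdsLT (a := (0 : ℝ))
    have h4 := (h₂.comp h3).neg
    rw [neg_neg] at h4
    refine h4.congr fun ε => ?_
    simp only [Function.comp, neg_neg, zero_add, inv_neg, neg_smul]
  · simpa using h₁

/-- A continuous function that is monogenic with respect to a surjective functional `ξ` factors
through `ξ` as a holomorphic function, if `Ω` is convex along the fibres of `ξ`. -/
theorem exists_differentiableOn_comp_eq {ξ : E →L[ℝ] ℂ} (hξ : Function.Surjective ξ) {Ω : Set E}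
    (hΩ : IsOpen Ω) (hconv : ∀ p ∈ Ω, ∀ q ∈ Ω, ξ p = ξ q → segment ℝ p q ⊆ Ω)
    {U : E → ℂ} (hU : ContinuousOn U Ω)
    (hder : ∀ p ∈ Ω, ∃ d, ∀ h, Tendsto (fun ε : ℝ => ε⁻¹ • (U (p + ε • h) - U p)) (𝓝[>] 0)
      (𝓝 (ξ h * d))) :
    ∃ F : ℂ → ℂ, IsOpen (ξ '' Ω) ∧ DifferentiableOn ℂ F (ξ '' Ω) ∧ ∀ p ∈ Ω, F (ξ p) = U p := by
  -- The linear section `σ` lifts a neighbourhood of `ξ p` to a plane piece through `p`, so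
  -- continuity and directional derivatives of `F` are read off from `U` there.
  obtain ⟨σ, hσ⟩ := ξ.exists_rightInverse_of_surjective (LinearMap.range_eq_top.2 hξ)
  replace hσ : ∀ w, ξ (σ w) = w := fun w => congrArg (fun f => f w) hσ
  set F : ℂ → ℂ := fun w => U (Function.invFunOn ξ Ω w) with hF
  have hFU : ∀ p ∈ Ω, F (ξ p) = U p := by
    intro p hp
    have hex : ∃ q ∈ Ω, ξ q = ξ p := ⟨p, hp, rfl⟩
    have h1 := Function.invFunOn_mem hex
    have h2 := Function.invFunOn_eq hex
    exact eq_of_segment_subset hU hder h2 (hconv _ h1 _ hp h2)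
  have hloc : ∀ p ∈ Ω, ∀ᶠ w in 𝓝 (ξ p), p + σ (w - ξ p) ∈ Ω := by
    intro p hp
    have hc : Continuous fun w => p + σ (w - ξ p) := by fun_prop
    exact hc.continuousAt.eventually_mem (hΩ.mem_nhds (by simpa using hp))
  have hFloc : ∀ p, ∀ w, p + σ (w - ξ p) ∈ Ω → F w = U (p + σ (w - ξ p)) := by
    intro p w hw
    rw [← hFU _ hw, map_add, hσ, add_sub_cancel]
  have hopen : IsOpen (ξ '' Ω) := by
    rw [isOpen_iff_mem_nhds]
    rintro _ ⟨p, hp, rfl⟩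
    filter_upwards [hloc p hp] with w hw
    exact ⟨_, hw, by rw [map_add, hσ, add_sub_cancel]⟩
  have hcont : ContinuousOn F (ξ '' Ω) := by
    rintro _ ⟨p, hp, rfl⟩
    have h1 : ContinuousAt (fun w => U (p + σ (w - ξ p))) (ξ p) := by
      have h2 : ContinuousAt U (p + σ (ξ p - ξ p)) := by
        rw [sub_self, map_zero, add_zero]
        exact hU.continuousAt (hΩ.mem_nhds hp)
      exact ContinuousAt.comp (f := fun w => p + σ (w - ξ p)) h2 (by fun_prop)
    exact (h1.congr ((hloc p hp).mono fun w hw => (hFloc p w hw).symm)).continuousWithinAt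
  have hdir : ∀ p ∈ Ω, ∃ d, ∀ c : ℂ, HasDerivAt (fun t : ℝ => F (ξ p + t * c)) (c * d) 0 := by
    intro p hp
    obtain ⟨d, hd⟩ := hder p hp
    refine ⟨d, fun c => ?_⟩
    have key : ∀ c : ℂ, Tendsto (fun ε : ℝ => ε⁻¹ • (F (ξ p + ε * c) - F (ξ p))) (𝓝[>] 0)
        (𝓝 (c * d)) := by
      intro c
      have h1 := hd (σ c)
      rw [hσ] at h1
      refine h1.congr' ?_
      have hc : Continuous fun ε : ℝ => p + ε • σ c := by fun_prop
      have h2 : ∀ᶠ ε : ℝ in 𝓝[>] 0, p + ε • σ c ∈ Ω := nhdsWithin_le_nhds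
        (hc.continuousAt.eventually_mem (hΩ.mem_nhds (by simpa using hp)))
      filter_upwards [h2] with ε hε
      rw [hFU p hp, ← hFU _ hε, map_add, map_smul, hσ, Complex.real_smul (x := ε) (z := c)]
    refine hasDerivAt_of_one_sided ?_ ?_
    · simpa using key c
    · have := key (-c)
      simpa using this
  choose! d hd using hdir
  set δ : ℂ → ℂ := fun w => d (Function.invFunOn ξ Ω w) with hδ
  have hdw : ∀ w ∈ ξ '' Ω, ∀ c : ℂ, HasDerivAt (fun t : ℝ => F (w + t * c)) (c * δ w) 0 := by
    intro w hw c
    have h1 := hd _ (Function.invFunOn_mem hw) c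
    rwa [Function.invFunOn_eq hw] at h1
  exact ⟨F, hopen, differentiableOn_of_partial hopen (d := δ) hcont
    (fun w hw => by simpa using hdw w hw 1) (fun w hw => hdw w hw Complex.I), hFU⟩

end Factorization

/-- Positive orientation makes `A` and `B` linearly independent over the reals, and cosine and sine
have no common zero. -/
theorem ellipse_ne_zero {A B : ℂ} (h : PositivelyOriented A B) (θ : ℝ) :
    (Real.cos θ : ℂ) * A + (Real.sin θ : ℂ) * B ≠ 0 := by
  intro h0
  have hre := congrArg Complex.re h0
  have him := congrArg Complex.im h0
  simp only [Complex.add_re, Complex.add_im, Complex.re_ofReal_mul, Complex.im_ofReal_mul,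
    Complex.zero_re, Complex.zero_im] at hre him
  simp only [PositivelyOriented, Complex.mul_im, Complex.conj_re, Complex.conj_im] at h
  have h1 : Real.sin θ * (A.re * B.im + -A.im * B.re) = 0 := by
    linear_combination A.re * him - A.im * hre
  have h2 : Real.cos θ * (A.re * B.im + -A.im * B.re) = 0 := by
    linear_combination B.im * hre - B.re * him
  have h3 := (mul_eq_zero.1 h1).resolve_right h.ne'
  have h4 := (mul_eq_zero.1 h2).resolve_right h.ne'
  have := Real.cos_sq_add_sin_sq θ
  rw [h3, h4] at this
  norm_num at this

/-- The Cauchy kernel integrated over a parametrized circle. -/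
theorem integral_cauchy_kernel_circle {F : ℂ → ℂ} {w₀ A : ℂ} (hA : A ≠ 0) {R : ℝ} (hR : 0 < R)
    (hF : DifferentiableOn ℂ F (closedBall w₀ (R * ‖A‖))) :
    ∫ t in (0 : ℝ)..1, F (w₀ + R * A * Complex.exp (2 * Real.pi * t * Complex.I)) /
        (w₀ + R * A * Complex.exp (2 * Real.pi * t * Complex.I) - w₀) *
        (R * A * (Complex.exp (2 * Real.pi * t * Complex.I) * (2 * Real.pi * Complex.I))) =
      2 * Real.pi * Complex.I * F w₀ := by
  have hg : DiffContOnCl ℂ (fun z => F (w₀ + A * z)) (ball 0 |R|) := by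
    refine DifferentiableOn.diffContOnCl ?_
    rw [abs_of_pos hR, closure_ball _ hR.ne']
    refine hF.comp (by fun_prop) fun z hz => ?_
    rw [mem_closedBall, dist_zero_right] at hz
    rw [mem_closedBall, dist_eq_norm, add_sub_cancel_left, norm_mul, mul_comm]
    gcongr
  have hmean := hg.circleAverage
  have hs := intervalIntegral.smul_integral_comp_mul_left (a := 0) (b := 1)
    (fun θ => F (w₀ + A * circleMap 0 R θ)) (2 * Real.pi)
  rw [mul_zero, mul_one] at hs
  rw [Real.circleAverage_def, ← hs, inv_smul_smul₀ (by positivity), mul_zero, add_zero] at hmean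
  rw [← hmean, ← intervalIntegral.integral_const_mul]
  refine intervalIntegral.integral_congr fun t _ => ?_
  have hRA : (R : ℂ) * A * Complex.exp (2 * Real.pi * t * Complex.I) ≠ 0 :=
    mul_ne_zero (mul_ne_zero (Complex.ofReal_ne_zero.2 hR.ne') hA) (Complex.exp_ne_zero _)
  have hcm : A * circleMap 0 R (2 * Real.pi * t) =
      R * A * Complex.exp (2 * Real.pi * t * Complex.I) := by
    simp only [circleMap, zero_add]
    push_cast
    ring
  rw [hcm, add_sub_cancel_left, ← mul_assoc (R * A : ℂ)]
  generalize (R : ℂ) * A * Complex.exp (2 * Real.pi * t * Complex.I) = c at hRA ⊢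
  field_simp

theorem polygonIntegral_congr {f : ℂ → ℂ} {Γ Γ' : ℝ → ℂ}
    (h : ∀ t ∈ Set.Icc (0 : ℝ) 1, Γ t = Γ' t) (n : ℕ) :
    polygonIntegral f Γ n = polygonIntegral f Γ' n :=
  Finset.sum_congr rfl fun j hj => by
    rw [h _ (div_mem_Icc (Finset.mem_range.1 hj).le), h _ (div_mem_Icc (Finset.mem_range.1 hj))]

theorem exists_scale {η K : ℝ} (hη : 0 < η) (hK : 0 ≤ K) :
    ∃ τ : ℝ, 0 < τ ∧ τ ≤ 1 ∧ τ * K < η := by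
  refine ⟨min 1 (η / (K + 1)), by positivity, min_le_left _ _, ?_⟩
  calc min 1 (η / (K + 1)) * K ≤ η / (K + 1) * K := by gcongr; exact min_le_right _ _
    _ < η := by
      rw [div_mul_eq_mul_div, div_lt_iff₀ (by positivity)]
      nlinarith

/-- **Cauchy's integral formula** for a rectifiable curve that is homotopic to an ellipse. -/
theorem tendsto_sum_cauchy_kernel {D : Set ℂ} (hD : IsOpen D) {F : ℂ → ℂ}
    (hF : DifferentiableOn ℂ F D) {w₀ A B : ℂ} {r : ℝ} (hr : 0 < r) (hAB : PositivelyOriented A B)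
    (hell : ∀ τ ∈ Set.Icc (0 : ℝ) 1, ∀ θ : ℝ,
      w₀ + τ * (r * ((Real.cos θ : ℂ) * A + (Real.sin θ : ℂ) * B)) ∈ D)
    {Γ : ℝ → ℂ} (hΓ : ContinuousOn Γ (Set.Icc 0 1)) (hΓv : BoundedVariationOn Γ (Set.Icc 0 1))
    {H : ℝ × ℝ → ℂ} (hH : ContinuousOn H (Set.Icc 0 1 ×ˢ Set.Icc 0 1))
    (hHD : ∀ p ∈ Set.Icc (0 : ℝ) 1 ×ˢ Set.Icc (0 : ℝ) 1, H p ∈ D \ {w₀})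
    (hcl : ∀ s ∈ Set.Icc (0 : ℝ) 1, H (s, 0) = H (s, 1))
    (hH0 : ∀ t ∈ Set.Icc (0 : ℝ) 1, H (0, t) = Γ t)
    (hH1 : ∀ t ∈ Set.Icc (0 : ℝ) 1, H (1, t) = w₀ + r * ((Real.cos (2 * Real.pi * t) : ℂ) * A +
      (Real.sin (2 * Real.pi * t) : ℂ) * B)) :
    Tendsto (fun n : ℕ => ∑ j ∈ Finset.range n, F (Γ ((j : ℝ) / n)) / (Γ ((j : ℝ) / n) - w₀) *
      (Γ (((j + 1 : ℕ) : ℝ) / n) - Γ ((j : ℝ) / n))) atTop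
      (𝓝 (2 * Real.pi * Complex.I * F w₀)) := by
  let ell : ℂ → ℝ → ℂ := fun X t => (Real.cos (2 * Real.pi * t) : ℂ) * A +
    (Real.sin (2 * Real.pi * t) : ℂ) * X
  have hw₀ : w₀ ∈ D := by simpa using hell 0 (by simp) 0
  have hA : A ≠ 0 := by
    rintro rfl
    simp [PositivelyOriented] at hAB
  have hr0 : (r : ℂ) ≠ 0 := Complex.ofReal_ne_zero.2 hr.ne'
  obtain ⟨η, hη, hηD⟩ := Metric.isOpen_iff.1 hD w₀ hw₀
  -- `D` need not contain the circle of radius `r * ‖A‖`, so the ellipse is first shrunk into a disc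
  -- inside `D`. The bound `2 * ‖A‖ + ‖B‖` covers `ell X` for every `X` on the segment from `B` to
  -- `I * A`.
  obtain ⟨τ, hτ, hτ1, hτη⟩ := exists_scale hη (K := r * (2 * ‖A‖ + ‖B‖)) (by positivity)
  have hτ0 : (τ : ℂ) ≠ 0 := Complex.ofReal_ne_zero.2 hτ.ne'
  have hU : IsOpen (D \ {w₀}) := hD.sdiff isClosed_singleton
  set f : ℂ → ℂ := fun w => F w / (w - w₀) with hf_def
  have hf : DifferentiableOn ℂ f (D \ {w₀}) :=
    (hF.mono Set.sdiff_subset).div (by fun_prop) fun w hw => sub_ne_zero.2 hw.2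
  have hmem : ∀ {x : ℂ}, w₀ + x ∈ D → x ≠ 0 → w₀ + x ∈ D \ {w₀} := fun h h0 =>
    ⟨h, fun h1 => h0 (by simpa using h1)⟩
  have hcase0 : ∀ X : ℂ, ell X 0 = ell X 1 := fun X => by simp [ell]
  have h1 := polygonIntegral_eq_of_homotopy hU hf hH hHD hcl
  have h2 := polygonIntegral_eq_of_homotopy hU hf
    (H := fun p => w₀ + ((1 - p.1 + p.1 * τ : ℝ) : ℂ) * (r * ell B p.2))
    (Continuous.continuousOn (by simp only [ell]; fun_prop)) (by
      rintro ⟨s, t⟩ ⟨hs, -⟩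
      simp only at hs ⊢
      have hpos : 0 < 1 - s + s * τ := by
        rcases eq_or_lt_of_le hs.1 with h | h
        · rw [← h]; simp
        · nlinarith [hs.2]
      exact hmem (hell _ ⟨hpos.le, by nlinarith [hs.1]⟩ _)
        (mul_ne_zero (Complex.ofReal_ne_zero.2 hpos.ne') (mul_ne_zero hr0 (ellipse_ne_zero hAB _))))
    (fun s _ => by simp only [hcase0])
  -- The vectors positively oriented with `A` form an open half-plane; it contains `B` and `I * A`,
  -- hence the segment between them. So the ellipse deforms to a circle without meeting `w₀`.
  have hor : ∀ s ∈ Set.Icc (0 : ℝ) 1,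
      PositivelyOriented A (((1 - s : ℝ) : ℂ) * B + (s : ℂ) * (Complex.I * A)) := by
    intro s hs
    have hA2 : 0 < A.re * A.re + A.im * A.im := by
      have := Complex.normSq_pos.2 hA
      rwa [Complex.normSq_apply] at this
    simp only [PositivelyOriented, Complex.mul_im, Complex.conj_re, Complex.conj_im, Complex.add_im,
      Complex.add_re, Complex.ofReal_re, Complex.ofReal_im, Complex.mul_re, Complex.I_re,
      Complex.I_im] at hAB ⊢
    rcases eq_or_lt_of_le hs.1 with h | h
    · rw [← h]; linarith
    · have := mul_pos h hA2
      have := mul_nonneg (sub_nonneg.2 hs.2) hAB.le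
      linarith
  have hball : ∀ s ∈ Set.Icc (0 : ℝ) 1, ∀ t,
      w₀ + τ * (r * ell (((1 - s : ℝ) : ℂ) * B + (s : ℂ) * (Complex.I * A)) t) ∈ ball w₀ η := by
    intro s hs t
    rw [mem_ball, dist_eq_norm, add_sub_cancel_left, norm_mul, norm_mul, Complex.norm_real,
      Complex.norm_real, Real.norm_of_nonneg hτ.le, Real.norm_of_nonneg hr.le]
    refine lt_of_le_of_lt ?_ hτη
    gcongr
    have hX : ‖((1 - s : ℝ) : ℂ) * B + (s : ℂ) * (Complex.I * A)‖ ≤ ‖B‖ + ‖A‖ := by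
      refine (norm_add_le _ _).trans (add_le_add ?_ ?_)
      · rw [norm_mul, Complex.norm_real, Real.norm_of_nonneg (sub_nonneg.2 hs.2)]
        exact mul_le_of_le_one_left (norm_nonneg _) (by linarith [hs.1])
      · rw [norm_mul, norm_mul, Complex.norm_I, one_mul, Complex.norm_real,
          Real.norm_of_nonneg hs.1]
        exact mul_le_of_le_one_left (norm_nonneg _) hs.2
    have hcos : ‖(Real.cos (2 * Real.pi * t) : ℂ) * A‖ ≤ ‖A‖ := by
      rw [norm_mul, Complex.norm_real]
      exact mul_le_of_le_one_left (norm_nonneg _) (Real.abs_cos_le_one _)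
    have hsin : ∀ X : ℂ, ‖(Real.sin (2 * Real.pi * t) : ℂ) * X‖ ≤ ‖X‖ := fun X => by
      rw [norm_mul, Complex.norm_real]
      exact mul_le_of_le_one_left (norm_nonneg _) (Real.abs_sin_le_one _)
    refine (norm_add_le _ _).trans ?_
    linarith [hsin (((1 - s : ℝ) : ℂ) * B + (s : ℂ) * (Complex.I * A))]
  have h3 := polygonIntegral_eq_of_homotopy hU hf
    (H := fun p => w₀ + τ * (r * ell (((1 - p.1 : ℝ) : ℂ) * B + (p.1 : ℂ) * (Complex.I * A)) p.2))
    (Continuous.continuousOn (by simp only [ell]; fun_prop)) (by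
      rintro ⟨s, t⟩ ⟨hs, -⟩
      simp only at hs ⊢
      exact hmem (hηD (hball s hs t)) (mul_ne_zero hτ0 (mul_ne_zero hr0
        (ellipse_ne_zero (hor s hs) _))))
    (fun s _ => by simp only [hcase0])
  have hcirc : ∀ t : ℝ, ell (Complex.I * A) t = A * Complex.exp (2 * Real.pi * t * Complex.I) := by
    intro t
    simp only [ell]
    rw [Complex.exp_mul_I]
    push_cast
    ring
  have h4 := polygonIntegral_eq_integral hU hf
    (Γ := fun t : ℝ => w₀ + (τ * r : ℝ) * A * Complex.exp (2 * Real.pi * t * Complex.I))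
    (Γ' := fun t : ℝ => (τ * r : ℝ) * A * (Complex.exp (2 * Real.pi * t * Complex.I) *
      (2 * Real.pi * Complex.I)))
    (fun t => by
      have e1 : HasDerivAt (fun t : ℝ => 2 * Real.pi * (t : ℂ) * Complex.I)
          (2 * Real.pi * 1 * Complex.I) t :=
        ((HasDerivAt.ofReal_comp (hasDerivAt_id t)).const_mul _).mul_const _
      rw [mul_one] at e1
      exact (e1.cexp.const_mul _).const_add _)
    (by fun_prop)
    (fun t _ => by
      have e1 := hball 1 (by simp) t
      simp only [sub_self, Complex.ofReal_zero, zero_mul, zero_add, Complex.ofReal_one, one_mul,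
        hcirc] at e1
      have e2 : (τ : ℂ) * (r * (A * Complex.exp (2 * Real.pi * t * Complex.I))) =
          (τ * r : ℝ) * A * Complex.exp (2 * Real.pi * t * Complex.I) := by push_cast; ring
      rw [e2] at e1
      refine hmem (hηD e1) ?_
      rw [← e2]
      exact mul_ne_zero hτ0 (mul_ne_zero hr0 (mul_ne_zero hA (Complex.exp_ne_zero _))))
  have h5 := integral_cauchy_kernel_circle (F := F) (w₀ := w₀) hA (mul_pos hτ hr) (hF.mono (by
    refine (closedBall_subset_ball ?_).trans hηD
    refine lt_of_le_of_lt ?_ hτη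
    rw [mul_assoc]
    gcongr
    linarith [norm_nonneg A, norm_nonneg B]))
  have hΓD : ∀ t ∈ Set.Icc (0 : ℝ) 1, Γ t ∈ D \ {w₀} := fun t ht => by
    rw [← hH0 t ht]
    exact hHD _ ⟨by simp, ht⟩
  have h6 := tendsto_sum_sub_polygonIntegral hU hf.continuousOn hΓ hΓv hΓD
  have h7 : ∀ᶠ n in atTop, polygonIntegral f Γ n = 2 * Real.pi * Complex.I * F w₀ := by
    filter_upwards [h1, h2, h3, h4] with n h1 h2 h3 h4
    rw [← h5, ← h4, ← polygonIntegral_congr hH0, h1, polygonIntegral_congr hH1]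
    have e2 : ∀ t, (w₀ + ((1 - (0 : ℝ) + 0 * τ : ℝ) : ℂ) * (r * ell B t)) = w₀ + r * ell B t :=
      fun t => by simp
    have e3 : ∀ t, (w₀ + ((1 - (1 : ℝ) + 1 * τ : ℝ) : ℂ) * (r * ell B t)) =
        w₀ + τ * (r * ell B t) := fun t => by simp
    have e4 : ∀ t, w₀ + τ * (r * ell (((1 - (0 : ℝ) : ℝ) : ℂ) * B + ((0 : ℝ) : ℂ) *
        (Complex.I * A)) t) = w₀ + τ * (r * ell B t) := fun t => by simp
    have e5 : ∀ t : ℝ, w₀ + τ * (r * ell (((1 - (1 : ℝ) : ℝ) : ℂ) * B + ((1 : ℝ) : ℂ) *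
        (Complex.I * A)) t) =
        w₀ + (τ * r : ℝ) * A * Complex.exp (2 * Real.pi * t * Complex.I) := fun t => by
      simp only [sub_self, Complex.ofReal_zero, zero_mul, zero_add, Complex.ofReal_one, one_mul,
        hcirc]
      push_cast
      ring
    simp only [e2, e3] at h2
    simp only [e4, e5] at h3
    exact h2.trans h3
  have h8 := h6.add (tendsto_const_nhds.congr' (h7.mono fun n h => h.symm))
  rw [zero_add] at h8
  exact h8.congr fun n => by simp only [f]; ring

end GMonogenic

/-! ### Diagonalization in the basis, and passage from scalar to quaternionic integrals -/

namespace GMonogenic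

open Metric Filter

theorem coord_add (k : Fin 4) (v w : ℍ[ℂ]) : coord k (v + w) = coord k v + coord k w := by
  fin_cases k <;> simp [coord] <;> ring

theorem coord_smul (k : Fin 4) (c : ℂ) (w : ℍ[ℂ]) : coord k (c • w) = c * coord k w := by
  fin_cases k <;> simp [coord] <;> ring

theorem coord_real_smul (k : Fin 4) (c : ℝ) (w : ℍ[ℂ]) : coord k (c • w) = c • coord k w := by
  fin_cases k <;> simp [coord] <;> ring

theorem coord_sub (k : Fin 4) (v w : ℍ[ℂ]) : coord k (v - w) = coord k v - coord k w := by
  fin_cases k <;> simp [coord] <;> ring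

theorem ext_coord {v w : ℍ[ℂ]} (h : ∀ k, coord k v = coord k w) : v = w := by
  rw [← sum_coord_smul_e v, ← sum_coord_smul_e w]
  simp only [h]

theorem coord_sum_smul_e (c : Fin 4 → ℂ) (k : Fin 4) : coord k (∑ j, c j • e j) = c k := by
  simp only [Fin.sum_univ_four, coord_add, coord_smul, coord_e]
  fin_cases k <;> simp

theorem continuous_coord (k : Fin 4) : Continuous (coord k) := by
  have h : Continuous fun w : ℍ[ℂ] => QuaternionAlgebra.equivTuple (-1 : ℂ) 0 (-1) w :=
    continuous_induced_dom
  have h0 : Continuous fun w : ℍ[ℂ] => w.re := (continuous_apply (0 : Fin 4)).comp h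
  have h1 : Continuous fun w : ℍ[ℂ] => w.imI := (continuous_apply (1 : Fin 4)).comp h
  have h2 : Continuous fun w : ℍ[ℂ] => w.imJ := (continuous_apply (2 : Fin 4)).comp h
  have h3 : Continuous fun w : ℍ[ℂ] => w.imK := (continuous_apply (3 : Fin 4)).comp h
  fin_cases k
  · exact h0.sub (continuous_const.mul h1)
  · exact h0.add (continuous_const.mul h1)
  · exact (continuous_const.mul h2).sub h3
  · exact (continuous_const.mul h2).add h3

theorem vec_one_one : vec 1 1 = 1 := by
  ext <;> simp [vec, e, qI_parts]
  norm_num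

/-- `e₁` and `e₂` are complementary orthogonal idempotents with `e₁ e₃ = e₃` and `e₂ e₄ = e₄`, so
left multiplication is diagonal with pattern `0, 1, 0, 1`. -/
theorem coord_vec_mul (c₁ c₂ : ℂ) (w : ℍ[ℂ]) (k : Fin 4) :
    coord k (vec c₁ c₂ * w) = ![c₁, c₂] (![0, 1, 0, 1] k) * coord k w := by
  have hI := Complex.I_sq
  fin_cases k <;> simp [coord, vec, e, qI_parts] <;> ring_nf <;>
    simp [hI] <;> ring

/-- On the right `e₃ e₂ = e₃` and `e₄ e₁ = e₄`, so `e₃` and `e₄` exchange eigenvalues; this is the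
only difference between the two formulas. -/
theorem coord_mul_vec (c₁ c₂ : ℂ) (w : ℍ[ℂ]) (k : Fin 4) :
    coord k (w * vec c₁ c₂) = ![c₁, c₂] (![0, 1, 1, 0] k) * coord k w := by
  have hI := Complex.I_sq
  fin_cases k <;> simp [coord, vec, e, qI_parts] <;> ring_nf <;>
    simp [hI] <;> ring

theorem vec_mul_vec (c₁ c₂ d₁ d₂ : ℂ) : vec c₁ c₂ * vec d₁ d₂ = vec (c₁ * d₁) (c₂ * d₂) := by
  refine ext_coord fun k => ?_
  rw [coord_vec_mul]
  fin_cases k <;> simp [vec, coord_add, coord_smul, coord_e]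

theorem ringInverse_vec {c₁ c₂ : ℂ} (h₁ : c₁ ≠ 0) (h₂ : c₂ ≠ 0) :
    Ring.inverse (vec c₁ c₂) = vec c₁⁻¹ c₂⁻¹ := by
  let x : ℍ[ℂ]ˣ := ⟨vec c₁ c₂, vec c₁⁻¹ c₂⁻¹,
    by rw [vec_mul_vec, mul_inv_cancel₀ h₁, mul_inv_cancel₀ h₂, vec_one_one],
    by rw [vec_mul_vec, inv_mul_cancel₀ h₁, inv_mul_cancel₀ h₂, vec_one_one]⟩
  exact Ring.inverse_unit x

/-- The real-linear functional `(x, y, z) ↦ x + y a + z b`. -/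
noncomputable def functional (a b : ℂ) : R3 →L[ℝ] ℂ :=
  LinearMap.toContinuousLinearMap
    { toFun := fun p => p 0 + p 1 * a + p 2 * b
      map_add' := fun p q => by
        simp only [PiLp.add_apply, Complex.ofReal_add]
        ring
      map_smul' := fun c p => by
        simp only [PiLp.smul_apply, smul_eq_mul, Complex.ofReal_mul, RingHom.id_apply,
          Complex.real_smul]
        ring }

theorem functional_apply (a b : ℂ) (p : R3) : functional a b p = p 0 + p 1 * a + p 2 * b := rfl

theorem mem_line_iff {a b : ℂ} {p : R3} : p ∈ line a b ↔ functional a b p = 0 := by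
  rw [functional_apply, Complex.ext_iff]
  simp [line]

theorem zeta_eq_vec (a₁ a₂ b₁ b₂ : ℂ) (p : R3) :
    zeta a₁ a₂ b₁ b₂ p = vec (functional a₁ b₁ p) (functional a₂ b₂ p) := by
  refine ext_coord fun k => ?_
  rw [zeta, ← vec_one_one]
  simp only [vec, coord_add, coord_smul, coord_real_smul, coord_e, functional_apply,
    Complex.real_smul]
  fin_cases k <;> simp

theorem zeta_add_smul (a₁ a₂ b₁ b₂ : ℂ) (p q : R3) (ε : ℝ) :
    zeta a₁ a₂ b₁ b₂ (p + ε • q) = zeta a₁ a₂ b₁ b₂ p + ε • zeta a₁ a₂ b₁ b₂ q := by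
  refine ext_coord fun k => ?_
  simp only [zeta_eq_vec, vec, map_add, map_smul, coord_add, coord_smul, coord_real_smul, coord_e,
    Complex.real_smul]
  ring

theorem zeta_sub (a₁ a₂ b₁ b₂ : ℂ) (p q : R3) :
    zeta a₁ a₂ b₁ b₂ (p - q) = zeta a₁ a₂ b₁ b₂ p - zeta a₁ a₂ b₁ b₂ q := by
  refine ext_coord fun k => ?_
  simp only [zeta_eq_vec, vec, map_sub, coord_sub, coord_add, coord_smul, coord_e]
  ring

theorem f₁_zeta (a₁ a₂ b₁ b₂ : ℂ) (p : R3) : f₁ (zeta a₁ a₂ b₁ b₂ p) = functional a₁ b₁ p := by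
  change coord 0 _ + coord 2 _ = _
  simp [zeta_eq_vec, vec, coord_add, coord_smul, coord_e]

theorem f₂_zeta (a₁ a₂ b₁ b₂ : ℂ) (p : R3) : f₂ (zeta a₁ a₂ b₁ b₂ p) = functional a₂ b₂ p := by
  change coord 1 _ + coord 3 _ = _
  simp [zeta_eq_vec, vec, coord_add, coord_smul, coord_e]

theorem exists_hasCoordIntegral {γ : ℝ → R3} (hγ : ContinuousOn γ (Set.Icc 0 1))
    (hγv : BoundedVariationOn γ (Set.Icc 0 1)) (j : Fin 3) {Ψ : ℝ → ℍ[ℂ]}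
    (hΨ : ∀ k, ContinuousOn (fun t => coord k (Ψ t)) (Set.Icc 0 1)) :
    ∃ W, HasCoordIntegral γ j Ψ W := by
  have hg : ContinuousOn (fun t => γ t j) (Set.Icc 0 1) :=
    (EuclideanSpace.proj j : R3 →L[ℝ] ℝ).continuous.comp_continuousOn hγ
  have hgv : BoundedVariationOn (fun t => γ t j) (Set.Icc 0 1) :=
    (EuclideanSpace.proj j : R3 →L[ℝ] ℝ).lipschitz.comp_boundedVariationOn hγv
  have hre : ∀ k, ∃ S, HasStieltjesIntegral (fun t => (coord k (Ψ t)).re) (fun t => γ t j) S :=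
    fun k => exists_hasStieltjesIntegral (Complex.continuous_re.comp_continuousOn (hΨ k)) hg hgv
  have him : ∀ k, ∃ S, HasStieltjesIntegral (fun t => (coord k (Ψ t)).im) (fun t => γ t j) S :=
    fun k => exists_hasStieltjesIntegral (Complex.continuous_im.comp_continuousOn (hΨ k)) hg hgv
  choose S hS using hre
  choose T hT using him
  refine ⟨∑ k, (⟨S k, T k⟩ : ℂ) • e k, fun k => ?_⟩
  rw [coord_sum_smul_e]
  exact ⟨hS k, hT k⟩

theorem HasCoordIntegral.tendsto {γ : ℝ → R3} {j : Fin 3} {Ψ : ℝ → ℍ[ℂ]} {W : ℍ[ℂ]}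
    (h : HasCoordIntegral γ j Ψ W) (k : Fin 4) :
    Tendsto (fun n : ℕ => ∑ i ∈ Finset.range n, coord k (Ψ ((i : ℝ) / n)) *
      ((γ (((i + 1 : ℕ) : ℝ) / n) j : ℂ) - (γ ((i : ℝ) / n) j : ℂ))) atTop (𝓝 (coord k W)) := by
  have h1 := ((Complex.continuous_ofReal.tendsto _).comp (h k).1.tendsto_uniform).add
    (((Complex.continuous_ofReal.tendsto _).comp (h k).2.tendsto_uniform).mul_const Complex.I)
  rw [Complex.re_add_im] at h1
  refine h1.congr fun n => ?_
  simp only [Function.comp, Complex.ofReal_sum, Finset.sum_mul, ← Finset.sum_add_distrib]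
  refine Finset.sum_congr rfl fun i _ => ?_
  conv_rhs => rw [← Complex.re_add_im (coord k (Ψ ((i : ℝ) / n)))]
  push_cast
  ring

/-- The curve integral of `A dζ B` can be computed in coordinates, where `dζ` becomes one of the
differentials `dξ₁`, `dξ₂`. -/
theorem exists_hasCurveIntegral (σ : Fin 4 → Fin 2) {a₁ a₂ b₁ b₂ : ℂ} {A B : ℍ[ℂ] → ℍ[ℂ]}
    {γ : ℝ → R3} (hγ : ContinuousOn γ (Set.Icc 0 1)) (hγv : BoundedVariationOn γ (Set.Icc 0 1))
    {u : Fin 4 → ℝ → ℂ} (hu : ∀ k, ContinuousOn (u k) (Set.Icc 0 1))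
    (hAB : ∀ t ∈ Set.Icc (0 : ℝ) 1, ∀ c₁ c₂ k, coord k (A (zeta a₁ a₂ b₁ b₂ (γ t)) * vec c₁ c₂ *
      B (zeta a₁ a₂ b₁ b₂ (γ t))) = ![c₁, c₂] (σ k) * u k t) {w : ℍ[ℂ]}
    (hlim : ∀ k, Tendsto (fun n : ℕ => ∑ i ∈ Finset.range n, u k ((i : ℝ) / n) *
      (functional (![a₁, a₂] (σ k)) (![b₁, b₂] (σ k)) (γ (((i + 1 : ℕ) : ℝ) / n)) -
        functional (![a₁, a₂] (σ k)) (![b₁, b₂] (σ k)) (γ ((i : ℝ) / n)))) atTop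
      (𝓝 (2 * Real.pi * Complex.I * coord k w))) :
    ∃ W, HasCurveIntegral a₁ a₂ b₁ b₂ γ A B W ∧
      w = (1 / (2 * (Real.pi : ℂ) * Complex.I)) • W := by
  have hAB1 : ∀ t ∈ Set.Icc (0 : ℝ) 1, ∀ k, coord k (A (zeta a₁ a₂ b₁ b₂ (γ t)) *
      B (zeta a₁ a₂ b₁ b₂ (γ t))) = u k t := fun t ht k => by
    have h := hAB t ht 1 1 k
    rw [vec_one_one, mul_one] at h
    rw [h]
    generalize σ k = s
    fin_cases s <;> simp
  have hc : ∀ c₁ c₂ k, ContinuousOn (fun t => coord k (A (zeta a₁ a₂ b₁ b₂ (γ t)) * vec c₁ c₂ *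
      B (zeta a₁ a₂ b₁ b₂ (γ t)))) (Set.Icc 0 1) := fun c₁ c₂ k =>
    (continuousOn_const.mul (hu k)).congr fun t ht => hAB t ht c₁ c₂ k
  obtain ⟨X, hX⟩ := exists_hasCoordIntegral hγ hγv 0
    (Ψ := fun t => A (zeta a₁ a₂ b₁ b₂ (γ t)) * B (zeta a₁ a₂ b₁ b₂ (γ t)))
    fun k => (hu k).congr fun t ht => hAB1 t ht k
  obtain ⟨Y, hY⟩ := exists_hasCoordIntegral hγ hγv 1 (hc a₁ a₂)
  obtain ⟨Z, hZ⟩ := exists_hasCoordIntegral hγ hγv 2 (hc b₁ b₂)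
  refine ⟨X + Y + Z, ⟨X, Y, Z, hX, hY, hZ, rfl⟩, ext_coord fun k => ?_⟩
  have hsum := ((hX.tendsto k).add (hY.tendsto k)).add (hZ.tendsto k)
  -- In coordinate `k` the `dx`, `dy`, `dz` integrands are `u k` times `1`, `a`, `b`, so the three
  -- sums add up to one sum against `dξ`.
  have heq : 2 * Real.pi * Complex.I * coord k w = coord k X + coord k Y + coord k Z := by
    refine tendsto_nhds_unique (hlim k) (hsum.congr fun n => ?_)
    rw [← Finset.sum_add_distrib, ← Finset.sum_add_distrib]
    refine Finset.sum_congr rfl fun i hi => ?_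
    have hi := div_mem_Icc (Finset.mem_range.1 hi).le
    rw [hAB1 _ hi, hAB _ hi, hAB _ hi, functional_apply, functional_apply]
    ring
  rw [coord_smul, coord_add, coord_add, ← heq]
  have : (Real.pi : ℂ) ≠ 0 := Complex.ofReal_ne_zero.2 Real.pi_ne_zero
  field_simp

theorem norm_cos_smul_add_sin_smul {u v : R3} (huv : Orthonormal ℝ ![u, v]) (θ : ℝ) :
    ‖Real.cos θ • u + Real.sin θ • v‖ = 1 := by
  have hu : ‖u‖ = 1 := by simpa using huv.1 0
  have hv : ‖v‖ = 1 := by simpa using huv.1 1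
  have huv' : inner ℝ u v = 0 := by simpa using huv.2 (i := 0) (j := 1) (by simp)
  have h := norm_add_sq_real (Real.cos θ • u) (Real.sin θ • v)
  rw [inner_smul_left, inner_smul_right, huv', norm_smul, norm_smul, hu, hv] at h
  simp only [Real.norm_eq_abs, mul_one, sq_abs, mul_zero, add_zero, Real.cos_sq_add_sin_sq] at h
  exact (pow_eq_one_iff_of_nonneg (norm_nonneg _) two_ne_zero).1 h

/-- The scalar Cauchy formula in `ℝ³` for a function that is monogenic with respect to the
functional `x + y a + z b`. -/
theorem tendsto_sum_functional {a b : ℂ} (hsurj : Function.Surjective (functional a b))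
    {Ω : Set R3} (hΩ : IsOpen Ω) (hconv : ConvexInDirection Ω (line a b))
    {U : R3 → ℂ} (hU : ContinuousOn U Ω)
    (hder : ∀ p ∈ Ω, ∃ d, ∀ h, Tendsto (fun ε : ℝ => ε⁻¹ • (U (p + ε • h) - U p)) (𝓝[>] 0)
      (𝓝 (functional a b h * d)))
    {p₀ u v : R3} {r ρ : ℝ} (huv : Orthonormal ℝ ![u, v]) (hr : 0 < r) (hrρ : r < ρ)
    (hball : ball p₀ ρ ⊆ Ω) (hpos : PositivelyOriented (functional a b u) (functional a b v))
    {γ : ℝ → R3} (hγ : ContinuousOn γ (Set.Icc 0 1)) (hγv : BoundedVariationOn γ (Set.Icc 0 1))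
    {X : Set R3} (hX : X ⊆ {p ∈ Ω | functional a b p ≠ functional a b p₀})
    (hom : ClosedHomotopicIn X γ (circle p₀ u v r)) :
    ContinuousOn (fun t => U (γ t) / (functional a b (γ t) - functional a b p₀)) (Set.Icc 0 1) ∧
    Tendsto (fun n : ℕ => ∑ i ∈ Finset.range n,
      U (γ ((i : ℝ) / n)) / (functional a b (γ ((i : ℝ) / n)) - functional a b p₀) *
        (functional a b (γ (((i + 1 : ℕ) : ℝ) / n)) - functional a b (γ ((i : ℝ) / n)))) atTop
      (𝓝 (2 * Real.pi * Complex.I * U p₀)) := by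
  obtain ⟨H, hH, hH0, hH1, hcl, hHX⟩ := hom
  set ξ := functional a b with hξ
  have hγX : ∀ t ∈ Set.Icc (0 : ℝ) 1, γ t ∈ Ω ∧ ξ (γ t) ≠ ξ p₀ := fun t ht => by
    have := hX (hHX 0 (by simp) t ht)
    rwa [hH0 t ht] at this
  have hξγ : ContinuousOn (fun t => ξ (γ t)) (Set.Icc 0 1) := ξ.continuous.comp_continuousOn hγ
  obtain ⟨F, hD, hF, hFU⟩ := exists_differentiableOn_comp_eq hsurj hΩ (fun p hp q hq h =>
    hconv p hp q hq (mem_line_iff.2 (by rw [map_sub, sub_eq_zero]; exact h.symm))) hU hder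
  refine ⟨(hU.comp hγ fun t ht => (hγX t ht).1).div (hξγ.sub continuousOn_const)
    fun t ht => sub_ne_zero.2 (hγX t ht).2, ?_⟩
  -- The shrunken ellipses required inside the domain of `F` are images of concentric circles in the
  -- ball about `p₀`.
  have hlim := tendsto_sum_cauchy_kernel hD hF (w₀ := ξ p₀) hr hpos (fun τ hτ θ => ?_)
    (Γ := fun t => ξ (γ t)) hξγ (ξ.lipschitz.comp_boundedVariationOn hγv) (H := fun p => ξ (H p))
    (ξ.continuous.comp_continuousOn hH) (fun p hp => ?_) (fun s hs => congrArg ξ (hcl s hs))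
    (fun t ht => congrArg ξ (hH0 t ht)) (fun t ht => ?_)
  · rw [hFU p₀ (hball (mem_ball_self (hr.trans hrρ)))] at hlim
    refine hlim.congr fun n => Finset.sum_congr rfl fun i hi => ?_
    rw [hFU _ (hγX _ (div_mem_Icc (Finset.mem_range.1 hi).le)).1]
  · refine ⟨p₀ + (τ * r) • (Real.cos θ • u + Real.sin θ • v), hball ?_, ?_⟩
    · rw [mem_ball, dist_eq_norm, add_sub_cancel_left, norm_smul, norm_cos_smul_add_sin_smul huv,
        mul_one, Real.norm_of_nonneg (mul_nonneg hτ.1 hr.le)]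
      nlinarith [hτ.2]
    · simp only [map_add, map_smul, Complex.real_smul]
      push_cast
      ring
  · have := hX (hHX p.1 hp.1 p.2 hp.2)
    exact ⟨⟨_, this.1, rfl⟩, this.2⟩
  · simp only [hH1 t ht, circle, map_add, map_smul, Complex.real_smul]

end GMonogenic

/-! ### Coordinates of monogenic mappings, and the final assembly -/

namespace GMonogenic

open Filter

theorem mem_functional_of_notMem_singularSet {a₁ a₂ b₁ b₂ : ℂ} {p₀ p : R3}
    (hp : p ∉ singularSet a₁ a₂ b₁ b₂ p₀) (s : Fin 2) :
    functional (![a₁, a₂] s) (![b₁, b₂] s) p ≠ functional (![a₁, a₂] s) (![b₁, b₂] s) p₀ := by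
  intro h
  refine hp ?_
  have h' : p - p₀ ∈ line (![a₁, a₂] s) (![b₁, b₂] s) :=
    mem_line_iff.2 (by rw [map_sub, sub_eq_zero]; exact h)
  fin_cases s
  · exact Or.inl h'
  · exact Or.inr h'

theorem ringInverse_zeta_sub {a₁ a₂ b₁ b₂ : ℂ} {p₀ p : R3}
    (hp : p ∉ singularSet a₁ a₂ b₁ b₂ p₀) :
    Ring.inverse (zeta a₁ a₂ b₁ b₂ p - zeta a₁ a₂ b₁ b₂ p₀) =
      vec (functional a₁ b₁ p - functional a₁ b₁ p₀)⁻¹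
        (functional a₂ b₂ p - functional a₂ b₂ p₀)⁻¹ := by
  rw [← zeta_sub, zeta_eq_vec, map_sub, map_sub]
  exact ringInverse_vec (sub_ne_zero.2 (mem_functional_of_notMem_singularSet hp 0))
    (sub_ne_zero.2 (mem_functional_of_notMem_singularSet hp 1))

theorem tendsto_coord_slope {a₁ a₂ b₁ b₂ : ℂ} {Φ : ℍ[ℂ] → ℍ[ℂ]} {p h : R3} {w : ℍ[ℂ]}
    (H : Tendsto (fun ε : ℝ => ε⁻¹ • (Φ (zeta a₁ a₂ b₁ b₂ p + ε • zeta a₁ a₂ b₁ b₂ h) -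
      Φ (zeta a₁ a₂ b₁ b₂ p))) (𝓝[>] 0) (𝓝 w)) (k : Fin 4) :
    Tendsto (fun ε : ℝ => ε⁻¹ • (coord k (Φ (zeta a₁ a₂ b₁ b₂ (p + ε • h))) -
      coord k (Φ (zeta a₁ a₂ b₁ b₂ p)))) (𝓝[>] 0) (𝓝 (coord k w)) := by
  refine (((continuous_coord k).tendsto _).comp H).congr fun ε => ?_
  rw [Function.comp, coord_real_smul, coord_sub, zeta_add_smul]

/-- Diagonality of left multiplication turns `h * Φ'` into a scalar multiple of `coord k Φ'`, with
factor the value of one functional at `h`. -/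
theorem RightGMonogenic.coord_slope {a₁ a₂ b₁ b₂ : ℂ} {Ω : Set R3} {Φ : ℍ[ℂ] → ℍ[ℂ]}
    (hΦ : RightGMonogenic a₁ a₂ b₁ b₂ Ω Φ) (k : Fin 4) {p : R3} (hp : p ∈ Ω) :
    ∃ d, ∀ h, Tendsto (fun ε : ℝ => ε⁻¹ • (coord k (Φ (zeta a₁ a₂ b₁ b₂ (p + ε • h))) -
      coord k (Φ (zeta a₁ a₂ b₁ b₂ p)))) (𝓝[>] 0)
      (𝓝 (functional (![a₁, a₂] (![0, 1, 0, 1] k)) (![b₁, b₂] (![0, 1, 0, 1] k)) h * d)) := by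
  obtain ⟨Φ', H⟩ := hΦ.2 _ (Set.mem_image_of_mem _ hp)
  refine ⟨coord k Φ', fun h => ?_⟩
  have h1 := tendsto_coord_slope (H _ ⟨h, rfl⟩) k
  rw [zeta_eq_vec _ _ _ _ h, coord_vec_mul] at h1
  convert h1 using 3
  generalize (![0, 1, 0, 1] k : Fin 2) = s
  fin_cases s <;> rfl

theorem LeftGMonogenic.coord_slope {a₁ a₂ b₁ b₂ : ℂ} {Ω : Set R3} {Φ : ℍ[ℂ] → ℍ[ℂ]}
    (hΦ : LeftGMonogenic a₁ a₂ b₁ b₂ Ω Φ) (k : Fin 4) {p : R3} (hp : p ∈ Ω) :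
    ∃ d, ∀ h, Tendsto (fun ε : ℝ => ε⁻¹ • (coord k (Φ (zeta a₁ a₂ b₁ b₂ (p + ε • h))) -
      coord k (Φ (zeta a₁ a₂ b₁ b₂ p)))) (𝓝[>] 0)
      (𝓝 (functional (![a₁, a₂] (![0, 1, 1, 0] k)) (![b₁, b₂] (![0, 1, 1, 0] k)) h * d)) := by
  obtain ⟨Φ', H⟩ := hΦ.2 _ (Set.mem_image_of_mem _ hp)
  refine ⟨coord k Φ', fun h => ?_⟩
  have h1 := tendsto_coord_slope (H _ ⟨h, rfl⟩) k
  rw [zeta_eq_vec _ _ _ _ h, coord_mul_vec] at h1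
  convert h1 using 3
  generalize (![0, 1, 1, 0] k : Fin 2) = s
  fin_cases s <;> rfl

end GMonogenic

open GMonogenic in
theorem theorem3 (a₁ a₂ b₁ b₂ : ℂ)
    (hlin : LinearIndependent ℝ ![(1 : ℍ[ℂ]), GMonogenic.vec a₁ a₂, GMonogenic.vec b₁ b₂])
    (hf₁ : GMonogenic.f₁ '' GMonogenic.E₃ a₁ a₂ b₁ b₂ = Set.univ)
    (hf₂ : GMonogenic.f₂ '' GMonogenic.E₃ a₁ a₂ b₁ b₂ = Set.univ)
    (Ω : Set GMonogenic.R3) (hΩ : GMonogenic.IsDomain3 Ω)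
    (hL₁ : GMonogenic.ConvexInDirection Ω (GMonogenic.line a₁ b₁))
    (hL₂ : GMonogenic.ConvexInDirection Ω (GMonogenic.line a₂ b₂))
    (Φ Φhat : ℍ[ℂ] → ℍ[ℂ])
    (hΦ : GMonogenic.RightGMonogenic a₁ a₂ b₁ b₂ Ω Φ)
    (hΦhat : GMonogenic.LeftGMonogenic a₁ a₂ b₁ b₂ Ω Φhat)
    (p₀ : GMonogenic.R3) (hp₀ : p₀ ∈ Ω) (ζ₀ : ℍ[ℂ]) (hζ₀ : ζ₀ = GMonogenic.zeta a₁ a₂ b₁ b₂ p₀)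
    (γ : ℝ → GMonogenic.R3) (hγ : GMonogenic.IsClosedJordanRectifiable γ)
    (hγΩ : ∀ t ∈ Set.Icc (0 : ℝ) 1, γ t ∈ Ω)
    (hemb : GMonogenic.EmbracesOnce a₁ a₂ b₁ b₂ Ω p₀ γ) :
    (∃ W : ℍ[ℂ],
      GMonogenic.HasCurveIntegral a₁ a₂ b₁ b₂ γ (fun ζ => Ring.inverse (ζ - ζ₀)) Φ W ∧
      Φ ζ₀ = (1 / (2 * (Real.pi : ℂ) * Complex.I)) • W) ∧
    (∃ W : ℍ[ℂ],
      GMonogenic.HasCurveIntegral a₁ a₂ b₁ b₂ γ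
        (fun ζ => Φhat ζ * Ring.inverse (ζ - ζ₀)) (fun _ => 1) W ∧
      Φhat ζ₀ = (1 / (2 * (Real.pi : ℂ) * Complex.I)) • W) := by
  subst hζ₀
  obtain ⟨u, v, r, ρ, huv, hr, hrρ, hball, -, hpos, hom⟩ := hemb
  have hsurj : ∀ s : Fin 2, Function.Surjective (functional (![a₁, a₂] s) (![b₁, b₂] s)) := by
    intro s w
    fin_cases s
    · obtain ⟨_, ⟨p, rfl⟩, h⟩ := hf₁.ge (Set.mem_univ w)
      exact ⟨p, (f₁_zeta a₁ a₂ b₁ b₂ p).symm.trans h⟩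
    · obtain ⟨_, ⟨p, rfl⟩, h⟩ := hf₂.ge (Set.mem_univ w)
      exact ⟨p, (f₂_zeta a₁ a₂ b₁ b₂ p).symm.trans h⟩
  have hconv : ∀ s : Fin 2, ConvexInDirection Ω (line (![a₁, a₂] s) (![b₁, b₂] s)) := by
    intro s
    fin_cases s
    · exact hL₁
    · exact hL₂
  have hpos' : ∀ s : Fin 2, PositivelyOriented (functional (![a₁, a₂] s) (![b₁, b₂] s) u)
      (functional (![a₁, a₂] s) (![b₁, b₂] s) v) := by
    rw [CirclePositive, f₁_zeta, f₁_zeta, f₂_zeta, f₂_zeta] at hpos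
    intro s
    fin_cases s
    · exact hpos.1
    · exact hpos.2
  have hX : ∀ s : Fin 2, Ω \ singularSet a₁ a₂ b₁ b₂ p₀ ⊆ {p ∈ Ω |
      functional (![a₁, a₂] s) (![b₁, b₂] s) p ≠ functional (![a₁, a₂] s) (![b₁, b₂] s) p₀} :=
    fun s p hp => ⟨hp.1, mem_functional_of_notMem_singularSet hp.2 s⟩
  have hγX : ∀ t ∈ Set.Icc (0 : ℝ) 1, γ t ∉ singularSet a₁ a₂ b₁ b₂ p₀ := by
    obtain ⟨H, -, hH0, -, -, hHX⟩ := hom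
    intro t ht
    rw [← hH0 t ht]
    exact (hHX 0 (by simp) t ht).2
  have main : ∀ (σ : Fin 4 → Fin 2) (Ψ : ℍ[ℂ] → ℍ[ℂ]),
      ContinuousOn (fun p => Ψ (zeta a₁ a₂ b₁ b₂ p)) Ω → _ → ∀ k, _ :=
    fun σ Ψ hΨ (hder : ∀ k, ∀ p ∈ Ω, ∃ d, ∀ h, Filter.Tendsto (fun ε : ℝ =>
        ε⁻¹ • (coord k (Ψ (zeta a₁ a₂ b₁ b₂ (p + ε • h))) - coord k (Ψ (zeta a₁ a₂ b₁ b₂ p))))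
        (𝓝[>] 0) (𝓝 (functional (![a₁, a₂] (σ k)) (![b₁, b₂] (σ k)) h * d))) k =>
      tendsto_sum_functional (hsurj (σ k)) hΩ.1 (hconv (σ k))
        (U := fun p => coord k (Ψ (zeta a₁ a₂ b₁ b₂ p)))
        ((continuous_coord k).comp_continuousOn hΨ) (hder k) huv hr hrρ hball (hpos' (σ k))
        hγ.continuousOn hγ.rectifiable (hX (σ k)) hom
  constructor
  · have hmain := main ![0, 1, 0, 1] Φ hΦ.1 fun k p hp => hΦ.coord_slope k hp
    refine exists_hasCurveIntegral ![0, 1, 0, 1] hγ.continuousOn hγ.rectifiable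
      (fun k => (hmain k).1) (fun t ht c₁ c₂ k => ?_) fun k => (hmain k).2
    -- The inverse kernel and the differential both act diagonally from the left, so the integrand
    -- in coordinate `k` is the scalar Cauchy kernel for the functional attached to `k`.
    rw [ringInverse_zeta_sub (hγX t ht), vec_mul_vec, coord_vec_mul]
    generalize (![0, 1, 0, 1] k : Fin 2) = s
    fin_cases s <;> simp <;> ring
  · have hmain := main ![0, 1, 1, 0] Φhat hΦhat.1 fun k p hp => hΦhat.coord_slope k hp
    refine exists_hasCurveIntegral ![0, 1, 1, 0] hγ.continuousOn hγ.rectifiable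
      (fun k => (hmain k).1) (fun t ht c₁ c₂ k => ?_) fun k => (hmain k).2
    -- Here kernel and differential both stand to the right of `Φhat`, hence the pattern `0, 1, 1,
    -- 0`.
    rw [ringInverse_zeta_sub (hγX t ht), mul_one, mul_assoc, vec_mul_vec, coord_mul_vec]
    generalize (![0, 1, 1, 0] k : Fin 2) = s
    fin_cases s <;> simp <;> ring
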